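/- Consider the ARMA--GARCH model \[ Y_t=\sum_{j=1}^{\overline p}\phi_j^\circ Y_{t-j}+X_t-\sum_{j=1}^{\overline q}\vartheta_j^\circ X_{t-j},\qquad X_t=\sigma_t\varepsilon_t,\qquad \sigma_t^2=\omega^\circ+\sum_{j=1}^{p}\alpha_j^\circ X_{t-j}^2+\sum_{j=1}^{q}\beta_j^\circ\sigma_{t-j}^2,\qquad t\in\mathbb Z, \] where the $\varepsilon_t$ are i.i.d. with mean $0$ and variance $1$, $\sigma_t\ge 0$, and, for some filtration $(\mathcal F_t)_{t\in\mathbb Z}$, $\varepsilon_t$ is $\mathcal F_t$-measurable and independent of $\mathcal F_{t-1}$, while $\sigma_t$ is $\mathcal F_{t-1}$-measurable. The processes $(X_t)$ and $(Y_t)$ are strictly stationary. The true parameter $\theta^\circ=(\phi^\circ,\vartheta^\circ,\omega^\circ,\alpha^\circ,\beta^\circ)$ lies in a parameter space $\varTheta=\varTheta_{\mathrm{ARMA}}\times\varTheta_{\mathrm{GARCH}}$ with $\varTheta_{\mathrm{ARMA}}\subset\mathbb R^{\overline p+\overline q}$ and $\varTheta_{\mathrm{GARCH}}\subset(0,\infty)\times[0,\infty)^{p+q}$,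 and $\alpha_j^\circ>0$, $\beta_j^\circ>0$ for all $j$. Suppose that (a) the polynomials $\phi(z)=1-\sum_{j=1}^{\overline p}\phi_j^\circ z^j$ and $\vartheta(z)=1-\sum_{j=1}^{\overline q}\vartheta_j^\circ z^j$ have no common roots, $\phi$ has no roots on the unit circle $|z|=1$, and $\vartheta$ has no roots in the closed unit disc $|z|\le1$; (b) $\sum_{j=1}^p\alpha_j^\circ+\sum_{j=1}^q\beta_j^\circ<1$; (c) $\operatorname{E}|X_t|^{2+\delta}<\infty$ for some $\delta>0$. Suppose further that there is an estimator $\widehat\theta\in\varTheta$ based on $Y_1,\dots,Y_n$ with $n^{1/2}|\widehat\theta-\theta^\circ|=O_{\operatorname P}(1)$ as $n\to\infty$. For $\theta\in\varTheta$ and $t\ge1$ define \[ \widehat X_t(\theta)=Y_t-\sum_{j=1}^{\overline p}\phi_jY_{t-j}+\sum_{j=1}^{\overline q}\vartheta_j\widehat X_{t-j}(\theta),\qquad \widehat\sigma_t^2(\theta)=\omega+\sum_{j=1}^p\alpha_j\widehat X_{t-j}^2(\theta)+\sum_{j=1}^q\beta_j\widehat\sigma_{t-j}^2(\theta), \] where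 in these recursions $Y_t$, $\widehat X_t(\theta)$ and $\widehat\sigma_t^2(\theta)$ are replaced by $0$ for $t\le0$, and put $\widehat\varepsilon_t(\theta)=\widehat X_t(\theta)/\widehat\sigma_t(\theta)$ and $N_n(\eta)=\{\theta\in\varTheta: n^{1/2}|\theta-\theta^\circ|\le\eta\}$. Then for every $\eta>0$ there exist random variables $m_t=m_{n,t}(\eta)\ge0$ and $s_t=s_{n,t}(\eta)\ge0$ such that for every sequence of integers $\ell_n\le n$ with $\ell_n\to\infty$ we have $\max_{t=\ell_n,\dots,n}m_t=o_{\operatorname P}(1)$, $\max_{t=\ell_n,\dots,n}s_t=o_{\operatorname P}(1)$ and, with probability approaching $1$ as $n\to\infty$, \[ |\varepsilon_t|(1-s_t)-m_t\le|\widehat\varepsilon_t(\theta)|\le|\varepsilon_t|(1+s_t)+m_t\qquad\text{for all }t=\ell_n,\dots,n\text{ and all }\theta\in N_n(\eta). \] -/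

import Mathlib

open MeasureTheory ProbabilityTheory Filter Topology
open scoped ENNReal

namespace ArmaGarch

/-- Parameters of an ARMA(`P`, `Q`)--GARCH(`p`, `q`) model: the ARMA part `(φ, ϑ)` and the GARCH
part `(ω, α, β)`. The coefficient with mathematical index `j = 1, 2, …` is stored at
`j - 1 : Fin _`. The type carries the (product) sup norm. -/
abbrev Param (P Q p q : ℕ) : Type :=
  ((Fin P → ℝ) × (Fin Q → ℝ)) × (ℝ × (Fin p → ℝ) × (Fin q → ℝ))

namespace Param

variable {P Q p q : ℕ}

/-- The autoregressive coefficients. -/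
def phi (θ : Param P Q p q) : Fin P → ℝ := θ.1.1

/-- The moving average coefficients. -/
def vartheta (θ : Param P Q p q) : Fin Q → ℝ := θ.1.2

/-- The intercept of the GARCH recursion. -/
def omega (θ : Param P Q p q) : ℝ := θ.2.1

/-- The coefficients of the squared errors in the GARCH recursion. -/
def alpha (θ : Param P Q p q) : Fin p → ℝ := θ.2.2.1

/-- The coefficients of the lagged variances in the GARCH recursion. -/
def beta (θ : Param P Q p q) : Fin q → ℝ := θ.2.2.2

end Param

/-- The value at `z` of the polynomial `1 - c₁ z - c₂ z² - … - c_k z^k`. -/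
noncomputable def lagPoly {k : ℕ} (c : Fin k → ℝ) (z : ℂ) : ℂ :=
  1 - ∑ j : Fin k, (c j : ℂ) * z ^ ((j : ℕ) + 1)

/-- Strict stationarity of a process indexed by `ℤ`: its law on path space is invariant under
all time shifts. -/
def StrictlyStationary {Ω : Type*} [MeasurableSpace Ω] (μ : Measure Ω) (Z : ℤ → Ω → ℝ) : Prop :=
  ∀ h : ℤ, IdentDistrib (fun w (t : ℤ) => Z t w) (fun w (t : ℤ) => Z (t + h) w) μ μ

/-- The process `Y` follows the ARMA--GARCH model with parameter `θ`, ARMA errors `X`,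
volatility `σ` and i.i.d. innovations `ε` of mean zero and unit variance. The filtration `ℱ` is
the information flow: `σ t` is known at time `t - 1`, and `ε t` is independent of what is known
at time `t - 1`. -/
structure IsModel {Ω : Type*} [mΩ : MeasurableSpace Ω] (μ : Measure Ω) (ℱ : Filtration ℤ mΩ)
    {P Q p q : ℕ} (θ : Param P Q p q) (Y X σ ε : ℤ → Ω → ℝ) : Prop where
  measurable_Y : ∀ t, Measurable (Y t)
  measurable_X : ∀ t, Measurable (X t)
  measurable_sigma : ∀ t, Measurable[ℱ (t - 1)] (σ t)
  measurable_eps : ∀ t, Measurable[ℱ t] (ε t)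
  /-- The innovations are i.i.d. with mean zero and unit variance. -/
  iIndepFun_eps : iIndepFun ε μ
  identDistrib_eps : ∀ t, IdentDistrib (ε t) (ε 0) μ μ
  memLp_eps : ∀ t, MemLp (ε t) 2 μ
  mean_eps : ∀ t, ∫ w, ε t w ∂μ = 0
  variance_eps : ∀ t, ∫ w, (ε t w) ^ 2 ∂μ = 1
  /-- The innovation at time `t` is independent of the past. -/
  indep_past : ∀ t, Indep (MeasurableSpace.comap (ε t) inferInstance) (ℱ (t - 1)) μ
  /-- The ARMA equation. -/
  arma : ∀ t, ∀ᵐ w ∂μ, Y t w = ∑ j : Fin P, θ.phi j * Y (t - ((j : ℕ) + 1)) w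
    + X t w - ∑ j : Fin Q, θ.vartheta j * X (t - ((j : ℕ) + 1)) w
  /-- The GARCH equations. -/
  garch : ∀ t, ∀ᵐ w ∂μ, X t w = σ t w * ε t w
  sigma_nonneg : ∀ t, ∀ᵐ w ∂μ, 0 ≤ σ t w
  sigma_sq : ∀ t, ∀ᵐ w ∂μ, (σ t w) ^ 2 = θ.omega
    + ∑ j : Fin p, θ.alpha j * (X (t - ((j : ℕ) + 1)) w) ^ 2
    + ∑ j : Fin q, θ.beta j * (σ (t - ((j : ℕ) + 1)) w) ^ 2

/-- The estimated ARMA errors `X̂_t(θ)` computed from the path `y` by the truncated recursion: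
`X̂_t(θ)` and the observations are set to zero for `t ≤ 0`. -/
noncomputable def xHat {P Q p q : ℕ} (θ : Param P Q p q) (y : ℤ → ℝ) (t : ℤ) : ℝ :=
  if _h : t ≤ 0 then 0
  else y t
    - ∑ j : Fin P, θ.phi j *
        (if t - ((j : ℕ) + 1) ≤ 0 then 0 else y (t - ((j : ℕ) + 1)))
    + ∑ j : Fin Q, θ.vartheta j * xHat θ y (t - ((j : ℕ) + 1))
termination_by t.toNat
decreasing_by omega

/-- The estimated variances `σ̂_t²(θ)` computed by the truncated recursion, with value zero for
`t ≤ 0`. -/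
noncomputable def sigmaHatSq {P Q p q : ℕ} (θ : Param P Q p q) (y : ℤ → ℝ) (t : ℤ) : ℝ :=
  if _h : t ≤ 0 then 0
  else θ.omega
    + ∑ j : Fin p, θ.alpha j * (xHat θ y (t - ((j : ℕ) + 1))) ^ 2
    + ∑ j : Fin q, θ.beta j * sigmaHatSq θ y (t - ((j : ℕ) + 1))
termination_by t.toNat
decreasing_by omega

/-- The standardized residual `ε̂_t(θ) = X̂_t(θ) / σ̂_t(θ)`. -/
noncomputable def residual {P Q p q : ℕ} (θ : Param P Q p q) (y : ℤ → ℝ) (t : ℤ) : ℝ :=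
  xHat θ y t / √(sigmaHatSq θ y t)

/-- The neighbourhood `N_n(η)` of `θ₀` in the parameter space `Θ`. All norms on the
finite-dimensional parameter space being equivalent, the choice of the norm does not affect
statements about all `η > 0`. -/
def nbhd {P Q p q : ℕ} (Θ : Set (Param P Q p q)) (θ₀ : Param P Q p q) (n : ℕ) (η : ℝ) :
    Set (Param P Q p q) :=
  {θ | θ ∈ Θ ∧ √(n : ℝ) * ‖θ - θ₀‖ ≤ η}

/-- There is an estimator with values in `Θ`, computed from `Y₁, …, Y_n`, such that
`√n ‖θ̂ - θ₀‖ = O_P(1)` as `n → ∞`. -/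
def HasRootNConsistentEstimator {Ω : Type*} [MeasurableSpace Ω] (μ : Measure Ω) {P Q p q : ℕ}
    (Θ : Set (Param P Q p q)) (θ₀ : Param P Q p q) (Y : ℤ → Ω → ℝ) : Prop :=
  ∃ θhat : (n : ℕ) → (Fin n → ℝ) → Param P Q p q,
    (∀ n, Measurable (θhat n)) ∧ (∀ n y, θhat n y ∈ Θ) ∧
    ∀ κ : ℝ, 0 < κ → ∃ M : ℝ, ∀ᶠ n : ℕ in atTop,
      μ {w | M < √(n : ℝ) * ‖θhat n (fun i => Y ((i : ℕ) + 1) w) - θ₀‖} ≤ ENNReal.ofReal κ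

/-- Uniform approximability of the innovations `|ε_t|` by the residuals `|ε̂_t(θ)|`, where
`N n η` is the neighbourhood over which uniformity is required. "With probability approaching
one" means that the (outer) probability of the complement tends to zero. -/
def UniformlyApproximable {Ω : Type*} [MeasurableSpace Ω] (μ : Measure Ω) {T : Type*}
    (N : ℕ → ℝ → Set T) (ε : ℤ → Ω → ℝ) (εhat : T → ℤ → Ω → ℝ) : Prop :=
  ∀ η : ℝ, 0 < η → ∃ m s : ℕ → ℕ → Ω → ℝ,
    (∀ n t, Measurable (m n t)) ∧ (∀ n t, Measurable (s n t)) ∧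
    (∀ n t w, 0 ≤ m n t w) ∧ (∀ n t w, 0 ≤ s n t w) ∧
    ∀ (l : ℕ → ℕ) (hl : ∀ n, l n ≤ n), Tendsto l atTop atTop →
      TendstoInMeasure μ
        (fun n w => (Finset.Icc (l n) n).sup' (Finset.nonempty_Icc.2 (hl n)) (fun t => m n t w))
        atTop (fun _ => (0 : ℝ)) ∧
      TendstoInMeasure μ
        (fun n w => (Finset.Icc (l n) n).sup' (Finset.nonempty_Icc.2 (hl n)) (fun t => s n t w))
        atTop (fun _ => (0 : ℝ)) ∧
      Tendsto (fun n => μ {w | ¬ ∀ t ∈ Finset.Icc (l n) n, ∀ θ ∈ N n η,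
          |ε (t : ℤ) w| * (1 - s n t w) - m n t w ≤ |εhat θ (t : ℤ) w| ∧
          |εhat θ (t : ℤ) w| ≤ |ε (t : ℤ) w| * (1 + s n t w) + m n t w})
        atTop (𝓝 0)

end ArmaGarch

/-!
The proof is pathwise. Fix a small `γ > 0` and put `c = 1 / 2 - γ`. The moment condition gives, for
almost every path, a random constant `R` with `|X t| ≤ R (1 + |t|) ^ c` for all `t`. The same rate
holds for `Y`, which is bounded in probability and solves `φ(B) Y = ϑ(B) X` for the lag operator
`B`: factor `φ` over `ℂ` and invert one factor `B - r` at a time, towards the past if `‖r‖ > 1` and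
towards the future if `‖r‖ < 1` (`ae_isBigO_of_aeval_lag`). It also holds for `σ` from any fixed
time on, since the coefficients `β` sum to less than one (`IsPath.exists_le_weight`).

Along such a path, an error `O(n^{-1/2})` in a coefficient costs at most
`n ^ (-1/2) * n ^ c = n ^ (-γ) ≤ t ^ (-γ)` at time `t ≤ n`, and setting the past before time `1` to
zero affects boundedly many equations only. The stability of `ϑ(B)`, which is proved in the weights
`(1 + t) ^ (-γ)`, gives `|X̂ t - X t| ≤ C t ^ (-γ)` uniformly in `θ` (`exists_abs_xHat_sub_le`).

For the volatilities, the error is measured relative to `σ t`, that is, one shows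
`|σ̂² t - σ² t| ≤ C t ^ (-γ) σ t` (`exists_abs_sigmaHatSq_sub_le`). On this scale the recursion is
a contraction: `∑ β j σ (t - j) ≤ √(∑ β j) σ t` by the Cauchy–Schwarz inequality, with
`√(∑ β j) < 1`. On the scale `σ² t` there would be no such gain. As `α j > 0` and `β j > 0`, the
other terms of the recursion are controlled by `σ t` as well. Hence `|σ̂ t - σ t| ≤ C t ^ (-γ)`,
and the residuals satisfy the claimed inequalities with errors `C t ^ (-γ)`, where `C` depends on
the path only through `R`.

On the event `R ≤ r`, the constant is absorbed by passing from `t ^ (-γ)` to `t ^ (-γ / 2)` for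
large `t`, so that `m` and `s` may be chosen as the deterministic sequence `(1 + t) ^ (-γ / 2)`.
The probability of `R > r` tends to zero as `r` tends to infinity.
-/

namespace ArmaGarch

/-! ### Polynomial weights -/

/-- The polynomial weight `(1 + |t|) ^ c` on the integers. -/
noncomputable def weight (c : ℝ) (t : ℤ) : ℝ := (1 + |(t : ℝ)|) ^ c

lemma weight_pos (c : ℝ) (t : ℤ) : 0 < weight c t := by
  unfold weight; positivity

lemma one_le_weight {c : ℝ} (hc : 0 ≤ c) (t : ℤ) : 1 ≤ weight c t :=
  Real.one_le_rpow (by linarith [abs_nonneg (t : ℝ)]) hc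

/-- Peetre's inequality. -/
lemma weight_add_le (c : ℝ) (t k : ℤ) :
    weight c (t + k) ≤ weight |c| k * weight c t := by
  unfold weight
  have ht := abs_nonneg (t : ℝ)
  have hk := abs_nonneg (k : ℝ)
  have htk := abs_nonneg ((t : ℝ) + k)
  push_cast
  rcases le_total 0 c with hc | hc
  · rw [abs_of_nonneg hc, ← Real.mul_rpow (by positivity) (by positivity)]
    refine Real.rpow_le_rpow (by positivity) ?_ hc
    nlinarith [abs_add_le (t : ℝ) k]
  · have h1 : (1 + |(t : ℝ)|) ^ (-c) ≤ (1 + |(k : ℝ)|) ^ (-c) * (1 + |(t : ℝ) + k|) ^ (-c) := by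
      rw [← Real.mul_rpow (by positivity) (by positivity)]
      refine Real.rpow_le_rpow (by positivity) ?_ (by linarith)
      have : |(t : ℝ)| ≤ |(t : ℝ) + k| + |(k : ℝ)| := by
        simpa using abs_sub ((t : ℝ) + k) k
      nlinarith
    rw [abs_of_nonpos hc]
    have h2 : 0 < (1 + |(t : ℝ)|) ^ (-c) := by positivity
    have h3 : 0 < (1 + |(t : ℝ) + k|) ^ (-c) := by positivity
    have e1 : (1 + |(t : ℝ)|) ^ c = ((1 + |(t : ℝ)|) ^ (-c))⁻¹ := by
      rw [← Real.rpow_neg (by positivity), neg_neg]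
    have e2 : (1 + |(t : ℝ) + k|) ^ c = ((1 + |(t : ℝ) + k|) ^ (-c))⁻¹ := by
      rw [← Real.rpow_neg (by positivity), neg_neg]
    rw [e1, e2, ← div_eq_mul_inv, le_div_iff₀ h2, inv_mul_le_iff₀ h3]
    linarith

lemma weight_le_one_add {c : ℝ} (hc : c ≤ 1) (k : ℤ) : weight c k ≤ 1 + |(k : ℝ)| := by
  unfold weight
  conv_rhs => rw [← Real.rpow_one (1 + |(k : ℝ)|)]
  exact Real.rpow_le_rpow_of_exponent_le (by linarith [abs_nonneg (k : ℝ)]) hc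

/-- A weight is moderate if a shift by `k` changes it at most by the factor `1 + |k|`. -/
def Moderate (h : ℤ → ℝ) : Prop :=
  (∀ t, 0 ≤ h t) ∧ ∀ t k : ℤ, h (t + k) ≤ (1 + |(k : ℝ)|) * h t

lemma moderate_weight {c : ℝ} (hc : |c| ≤ 1) : Moderate (weight c) :=
  ⟨fun t => (weight_pos c t).le, fun t k => (weight_add_le c t k).trans
    (mul_le_mul_of_nonneg_right (weight_le_one_add hc k) (weight_pos c t).le)⟩

lemma weight_mono {c : ℝ} (hc : 0 ≤ c) {u t : ℤ} (h : |u| ≤ |t|) : weight c u ≤ weight c t := by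
  have : |(u : ℝ)| ≤ |(t : ℝ)| := by exact_mod_cast h
  unfold weight
  gcongr

lemma weight_neg_le_one {γ : ℝ} (hγ : 0 ≤ γ) (t : ℤ) : weight (-γ) t ≤ 1 :=
  Real.rpow_le_one_of_one_le_of_nonpos (by linarith [abs_nonneg (t : ℝ)]) (by linarith)

lemma weight_half_sub_le {γ : ℝ} (hγ0 : 0 ≤ γ) (hγ1 : γ ≤ 1 / 2) {u t : ℤ} {M : ℝ}
    (hu : |(u : ℝ)| ≤ M) (ht : |(t : ℝ)| ≤ M) :
    weight (1 / 2 - γ) u ≤ √(1 + M) * weight (-γ) t := by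
  have hM : 0 ≤ M := (abs_nonneg _).trans hu
  calc weight (1 / 2 - γ) u ≤ (1 + M) ^ (1 / 2 - γ) := by
        unfold weight
        exact Real.rpow_le_rpow (by positivity) (by linarith) (by linarith)
    _ = √(1 + M) * (1 + M) ^ (-γ) := by
        rw [Real.sqrt_eq_rpow, ← Real.rpow_add (by positivity)]; congr 1
    _ ≤ √(1 + M) * weight (-γ) t := by
        gcongr
        unfold weight
        exact Real.rpow_le_rpow_of_nonpos (by positivity) (by linarith) (by linarith)

/-- Up to time `n`, the growth `(1 + |u|) ^ (1 / 2 - γ)` of a path times the estimation error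
`n^{-1/2}` is bounded by the decaying weight at any other time. -/
lemma weight_half_sub_le_sqrt {γ : ℝ} (hγ0 : 0 ≤ γ) (hγ1 : γ ≤ 1 / 2) {u t : ℤ} {n : ℕ}
    (hn : 1 ≤ n) (hu : |u| ≤ n) (ht : |t| ≤ n) :
    weight (1 / 2 - γ) u ≤ 2 * √(n : ℝ) * weight (-γ) t := by
  refine (weight_half_sub_le hγ0 hγ1 (M := n) (by exact_mod_cast hu)
    (by exact_mod_cast ht)).trans ?_
  have hn' : (1 : ℝ) ≤ n := by exact_mod_cast hn
  gcongr
  · exact (weight_pos _ _).le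
  · rw [Real.sqrt_le_left (by positivity), mul_pow, Real.sq_sqrt (by positivity)]
    linarith

lemma weight_sub_le {γ : ℝ} (hγ0 : 0 ≤ γ) {t k : ℤ} {m : ℕ} (hk : |k| ≤ m) :
    weight (-γ) (t - k) ≤ weight γ m * weight (-γ) t := by
  have h := weight_add_le (-γ) t (-k)
  rw [abs_neg, abs_of_nonneg hγ0, ← sub_eq_add_neg] at h
  refine h.trans (mul_le_mul_of_nonneg_right (weight_mono hγ0 ?_) (weight_pos _ _).le)
  simpa using hk

lemma weight_neg (γ : ℝ) (t : ℤ) : weight (-γ) t = (weight γ t)⁻¹ :=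
  Real.rpow_neg (by positivity) _

lemma summable_weight {b : ℝ} (hb : 1 < b) : Summable fun t : ℤ => weight (-b) t := by
  refine Summable.of_norm_bounded_eventually (Real.summable_abs_int_rpow hb) ?_
  have : ∀ᶠ t : ℤ in cofinite, t ≠ 0 := (Set.finite_singleton (0 : ℤ)).compl_mem_cofinite
  filter_upwards [this] with t ht
  rw [Real.norm_of_nonneg (weight_pos _ _).le]
  exact Real.rpow_le_rpow_of_nonpos (abs_pos.2 (by exact_mod_cast ht)) (by linarith) (by linarith)

lemma tendsto_weight_atTop {γ : ℝ} (hγ : 0 < γ) :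
    Tendsto (fun t : ℕ => weight γ t) atTop atTop := by
  refine (tendsto_rpow_atTop hγ).comp ?_
  simp only [Int.cast_natCast, Nat.abs_cast]
  exact tendsto_atTop_add_const_left _ _ tendsto_natCast_atTop_atTop

/-! ### Inverting lag polynomials -/

/-- The lag operator on complex sequences. -/
noncomputable def lag : Module.End ℂ (ℤ → ℂ) := LinearMap.funLeft ℂ ℂ fun t => t - 1

@[simp] lemma lag_apply (f : ℤ → ℂ) (t : ℤ) : lag f t = f (t - 1) := rfl

lemma lag_pow_apply (k : ℕ) (f : ℤ → ℂ) (t : ℤ) : (lag ^ k) f t = f (t - k) := by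
  induction k generalizing t with
  | zero => simp
  | succ k ih =>
    rw [pow_succ', Module.End.mul_apply, lag_apply, ih]
    congr 1; push_cast; ring

lemma aeval_X_sub_C_apply (r : ℂ) (f : ℤ → ℂ) (t : ℤ) :
    Polynomial.aeval lag (Polynomial.X - Polynomial.C r) f t = f (t - 1) - r * f t := by
  simp

/-- The sum `∑ aᵏ (1 + k)`: the norm, in a moderate weight, of the inverse of a first-order
recursion with coefficient `a`. -/
noncomputable def geomWeight (a : ℝ) : ℝ := ∑' k : ℕ, a ^ k * (1 + k)

lemma summable_geomWeight {a : ℝ} (ha0 : 0 ≤ a) (ha1 : a < 1) :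
    Summable fun k : ℕ => a ^ k * (1 + (k : ℝ)) := by
  have h := summable_pow_mul_geometric_of_norm_lt_one 1 (r := a)
    (by rwa [Real.norm_of_nonneg ha0])
  have h' := summable_geometric_of_lt_one ha0 ha1
  refine (h'.add h).congr fun k => ?_
  simp; ring

lemma geomWeight_nonneg {a : ℝ} (ha0 : 0 ≤ a) : 0 ≤ geomWeight a :=
  tsum_nonneg fun _ => by positivity

/-- Iterating a contractive first-order recursion in the direction `e = ± 1`. -/
lemma norm_le_of_recursion {h : ℤ → ℝ} (hh : Moderate h) {f : ℤ → ℂ} {a G : ℝ} {e t : ℤ}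
    (he : |e| = 1) (ha0 : 0 ≤ a) (ha1 : a < 1) (hG : 0 ≤ G) (K : ℕ)
    (hf : ∀ k : ℕ, k < K → ‖f (t + e * k)‖ ≤ a * ‖f (t + e * (k + 1))‖ + G * h (t + e * k)) :
    ‖f t‖ ≤ a ^ K * ‖f (t + e * K)‖ + geomWeight a * G * h t := by
  have key : ∀ K' ≤ K, ‖f t‖ ≤ a ^ K' * ‖f (t + e * K')‖
      + (∑ k ∈ Finset.range K', a ^ k * (1 + (k : ℝ))) * G * h t := by
    intro K' hK'
    induction K' with
    | zero => simp
    | succ k ih =>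
      refine (ih (by omega)).trans ?_
      have h1 := hf k (by omega)
      have h2 : h (t + e * k) ≤ (1 + (k : ℝ)) * h t := by
        have := hh.2 t (e * k)
        have e1 : |((e * k : ℤ) : ℝ)| = (k : ℝ) := by
          have : |e * (k : ℤ)| = k := by rw [abs_mul, he]; simp
          exact_mod_cast this
        rwa [e1] at this
      have h3 : a ^ k * ‖f (t + e * k)‖
          ≤ a ^ k * (a * ‖f (t + e * (k + 1))‖ + G * ((1 + (k : ℝ)) * h t)) := by
        gcongr
        exact h1.trans (by gcongr)
      rw [Finset.sum_range_succ, pow_succ]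
      push_cast
      nlinarith
  refine (key K le_rfl).trans ?_
  have := (summable_geomWeight ha0 ha1).sum_le_tsum (Finset.range K) (fun _ _ => by positivity)
  have h0 := hh.1 t
  gcongr
  exact this

/-- If all roots of a polynomial lie outside the closed unit disc, then the polynomial in the
lag operator is invertible on causal sequences, boundedly so in every moderate weight. -/
lemma exists_causal_bound {h : ℤ → ℝ} (hh : Moderate h) {φ : Polynomial ℂ} (hφ0 : φ ≠ 0)
    (hφ : ∀ z, ‖z‖ ≤ 1 → φ.eval z ≠ 0) :
    ∃ C : ℝ, 0 ≤ C ∧ ∀ (f : ℤ → ℂ) (n : ℤ) (g : ℝ), 0 ≤ g → (∀ t ≤ 0, f t = 0) →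
      (∀ t ≤ n, ‖Polynomial.aeval lag φ f t‖ ≤ g * h t) → ∀ t ≤ n, ‖f t‖ ≤ C * g * h t := by
  have single : ∀ r : ℂ, 1 < ‖r‖ → ∃ C : ℝ, 0 ≤ C ∧ ∀ (f : ℤ → ℂ) (n : ℤ) (g : ℝ), 0 ≤ g →
      (∀ t ≤ 0, f t = 0) →
      (∀ t ≤ n, ‖Polynomial.aeval lag (Polynomial.X - Polynomial.C r) f t‖ ≤ g * h t) →
      ∀ t ≤ n, ‖f t‖ ≤ C * g * h t := by
    intro r hr
    have hr0 : 0 < ‖r‖ := by linarith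
    have hi1 : ‖r‖⁻¹ < 1 := inv_lt_one_of_one_lt₀ hr
    refine ⟨geomWeight ‖r‖⁻¹, geomWeight_nonneg (by positivity), fun f n g hg hf0 hf t ht => ?_⟩
    have h0 := hh.1 t
    have hC := geomWeight_nonneg (a := ‖r‖⁻¹) (by positivity)
    rcases le_total t 0 with ht0 | ht0
    · rw [hf0 t ht0, norm_zero]; positivity
    · have := norm_le_of_recursion hh (f := f) (a := ‖r‖⁻¹) (G := g) (e := -1) (t := t)
        (by simp) (by positivity) hi1 hg t.toNat ?_
      · have ez : t + -1 * (t.toNat : ℤ) = 0 := by omega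
        rw [ez, hf0 0 le_rfl] at this
        simpa using this
      · intro k hk
        have h1 := hf (t + -1 * k) (by omega)
        rw [aeval_X_sub_C_apply] at h1
        have e1 : t + -1 * (k : ℤ) - 1 = t + -1 * (k + 1) := by ring
        rw [e1] at h1
        set u := t + -1 * (k : ℤ)
        have h2 : ‖r‖ * ‖f u‖ ≤ ‖f (t + -1 * (k + 1))‖ + g * h u := by
          rw [← norm_mul]
          have := norm_sub_le (f (t + -1 * (k + 1))) (f (t + -1 * (k + 1)) - r * f u)
          rw [sub_sub_cancel] at this
          linarith
        have h3 : ‖f u‖ ≤ ‖r‖⁻¹ * (‖f (t + -1 * (k + 1))‖ + g * h u) := by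
          rw [← div_eq_inv_mul, le_div_iff₀ hr0]; linarith
        have h4 : ‖r‖⁻¹ * (g * h u) ≤ 1 * (g * h u) :=
          mul_le_mul_of_nonneg_right hi1.le (mul_nonneg hg (hh.1 u))
        linarith
  have multi : ∀ s : Multiset ℂ, (∀ r ∈ s, 1 < ‖r‖) → ∃ C : ℝ, 0 ≤ C ∧
      ∀ (f : ℤ → ℂ) (n : ℤ) (g : ℝ), 0 ≤ g → (∀ t ≤ 0, f t = 0) →
      (∀ t ≤ n, ‖Polynomial.aeval lag (s.map fun r => Polynomial.X - Polynomial.C r).prod f t‖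
        ≤ g * h t) → ∀ t ≤ n, ‖f t‖ ≤ C * g * h t := by
    intro s
    induction s using Multiset.induction_on with
    | empty => exact fun _ => ⟨1, zero_le_one, fun f n g _ _ hf t ht => by simpa using hf t ht⟩
    | cons r s ih =>
      intro hs
      obtain ⟨C, hC, H⟩ := ih fun r' hr' => hs r' (Multiset.mem_cons_of_mem hr')
      obtain ⟨C', hC', H'⟩ := single r (hs r (Multiset.mem_cons_self r s))
      refine ⟨C' * C, by positivity, fun f n g hg hf0 hf t ht => ?_⟩
      rw [mul_assoc C']
      refine H' f n (C * g) (by positivity) hf0 ?_ t ht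
      refine H _ n g hg ?_ ?_
      · intro t ht
        rw [aeval_X_sub_C_apply, hf0 t ht, hf0 _ (by omega)]; simp
      · intro t ht
        have := hf t ht
        rwa [Multiset.map_cons, Multiset.prod_cons, mul_comm, map_mul,
          Module.End.mul_apply] at this
  have hlead : φ.leadingCoeff ≠ 0 := Polynomial.leadingCoeff_ne_zero.2 hφ0
  obtain ⟨C, hC, H⟩ := multi φ.roots fun r hr => by
    by_contra! hle
    exact hφ r hle ((Polynomial.mem_roots hφ0).1 hr)
  have hprod := (IsAlgClosed.splits φ).eq_prod_roots
  refine ⟨C * ‖φ.leadingCoeff‖⁻¹, by positivity, fun f n g hg hf0 hf t ht => ?_⟩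
  rw [mul_assoc C]
  refine H f n _ (by positivity) hf0 (fun t ht => ?_) t ht
  have := hf t ht
  rw [hprod, map_mul, Module.End.mul_apply, Polynomial.aeval_C] at this
  simp only [Module.algebraMap_end_apply, Pi.smul_apply, norm_smul] at this
  rw [mul_assoc, ← div_eq_inv_mul, le_div_iff₀ (norm_pos_iff.2 hlead)]
  linarith

/-- Boundedness in probability, uniformly in time, of a random complex sequence. -/
def BoundedInProbability {Ω : Type*} [MeasurableSpace Ω] (μ : Measure Ω) (Z : Ω → ℤ → ℂ) :
    Prop :=
  ∀ κ : ℝ≥0∞, 0 < κ → ∃ M : ℝ, 0 < M ∧ ∀ t, μ {w | M < ‖Z w t‖} ≤ κ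

lemma BoundedInProbability.aeval_X_sub_C {Ω : Type*} [MeasurableSpace Ω] {μ : Measure Ω}
    {Z : Ω → ℤ → ℂ} (hZ : BoundedInProbability μ Z) (r : ℂ) :
    BoundedInProbability μ fun w =>
      Polynomial.aeval lag (Polynomial.X - Polynomial.C r) (Z w) := by
  intro κ hκ
  obtain ⟨M, hM, H⟩ := hZ (κ / 2) (ENNReal.half_pos hκ.ne')
  refine ⟨M + ‖r‖ * M, by positivity, fun t => ?_⟩
  calc _ ≤ μ ({w | M < ‖Z w (t - 1)‖} ∪ {w | M < ‖Z w t‖}) := by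
        refine measure_mono fun w hw => ?_
        by_contra hn
        simp only [Set.mem_union, Set.mem_ofPred_eq, not_or, not_lt] at hn
        change M + ‖r‖ * M
          < ‖Polynomial.aeval lag (Polynomial.X - Polynomial.C r) (Z w) t‖ at hw
        rw [aeval_X_sub_C_apply] at hw
        have h1 := norm_sub_le (Z w (t - 1)) (r * Z w t)
        rw [norm_mul] at h1
        nlinarith [norm_nonneg r]
    _ ≤ κ / 2 + κ / 2 := (measure_union_le _ _).trans (add_le_add (H _) (H _))
    _ = κ := ENNReal.add_halves κ

/-- A process that is bounded in probability and satisfies a contractive first-order recursion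
grows no faster than the forcing term: the contribution `aᴷ ‖Z (t ± K)‖` of the far past or
future tends to zero in probability. -/
lemma ae_isBigO_of_recursion {Ω : Type*} [MeasurableSpace Ω] {μ : Measure Ω}
    {h : ℤ → ℝ} (hh : Moderate h) {Z W : Ω → ℤ → ℂ} (hZ : BoundedInProbability μ Z)
    {a b : ℝ} {e : ℤ} (he : |e| = 1) (ha0 : 0 ≤ a) (ha1 : a < 1) (hb : 0 ≤ b)
    (hrec : ∀ w R, 0 ≤ R → (∀ t, ‖W w t‖ ≤ R * h t) →
      ∀ t, ‖Z w t‖ ≤ a * ‖Z w (t + e)‖ + b * R * h t) :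
    ∀ᵐ w ∂μ, W w =O[⊤] h → Z w =O[⊤] h := by
  have null : ∀ (t : ℤ) (ε : ℝ), 0 < ε → μ {w | ∃ R, 0 ≤ R ∧ (∀ t, ‖W w t‖ ≤ R * h t) ∧
      geomWeight a * (b * R) * h t + ε < ‖Z w t‖} = 0 := by
    intro t ε hε
    refine le_antisymm (ENNReal.le_of_forall_pos_le_add fun κ hκ _ => ?_) zero_le
    obtain ⟨M, hM, H⟩ := hZ κ (by exact_mod_cast hκ)
    obtain ⟨K, hK⟩ := exists_pow_lt_of_lt_one (div_pos hε hM) ha1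
    rw [zero_add]
    refine le_trans (measure_mono ?_) (H (t + e * K))
    rintro w ⟨R, hR, hW, hlt⟩
    have := norm_le_of_recursion hh (f := Z w) (t := t) (G := b * R) he ha0 ha1 (by positivity) K
      fun k _ => by
        have := hrec w R hR hW (t + e * k)
        rwa [add_assoc, show e * (k : ℤ) + e = e * (k + 1) by ring] at this
    rw [Set.mem_ofPred_eq]
    by_contra! hle
    have h1 : a ^ K * ‖Z w (t + e * K)‖ ≤ a ^ K * M := by gcongr
    rw [lt_div_iff₀ hM] at hK
    linarith
  have hall : ∀ᵐ w ∂μ, ∀ (t : ℤ) (N : ℕ), ¬ ∃ R, 0 ≤ R ∧ (∀ t, ‖W w t‖ ≤ R * h t) ∧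
      geomWeight a * (b * R) * h t + 1 / ((N : ℝ) + 1) < ‖Z w t‖ := by
    refine ae_all_iff.2 fun t => ae_all_iff.2 fun N => ?_
    rw [ae_iff]
    simpa using null t (1 / ((N : ℝ) + 1)) (by positivity)
  filter_upwards [hall] with w hw hW
  obtain ⟨R, hR, hWR⟩ := hW.exists_pos
  simp only [Asymptotics.isBigOWith_top] at hWR
  have hWR' : ∀ t, ‖W w t‖ ≤ R * h t := fun t => by
    simpa [abs_of_nonneg (hh.1 t)] using hWR t
  rw [Asymptotics.isBigO_top]
  refine ⟨geomWeight a * (b * R), fun t => ?_⟩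
  rw [Real.norm_of_nonneg (hh.1 t)]
  refine le_of_forall_pos_le_add fun ε hε => ?_
  obtain ⟨N, hN⟩ := exists_nat_one_div_lt hε
  by_contra! hlt
  exact hw t N ⟨R, hR.le, hWR', by linarith⟩

/-- If a polynomial has no roots on the unit circle, then a process `Z` that is bounded in
probability grows no faster than its image under the polynomial in the lag operator. -/
lemma ae_isBigO_of_aeval_lag {Ω : Type*} [MeasurableSpace Ω] {μ : Measure Ω}
    {h : ℤ → ℝ} (hh : Moderate h) {φ : Polynomial ℂ} (hφ0 : φ ≠ 0)
    (hφ : ∀ z, ‖z‖ = 1 → φ.eval z ≠ 0) {Z : Ω → ℤ → ℂ} (hZ : BoundedInProbability μ Z) :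
    ∀ᵐ w ∂μ, Polynomial.aeval lag φ (Z w) =O[⊤] h → Z w =O[⊤] h := by
  have single : ∀ r : ℂ, ‖r‖ ≠ 1 → ∀ Z : Ω → ℤ → ℂ, BoundedInProbability μ Z →
      ∀ᵐ w ∂μ, Polynomial.aeval lag (Polynomial.X - Polynomial.C r) (Z w) =O[⊤] h →
        Z w =O[⊤] h := by
    intro r hr Z hZ
    rcases lt_or_gt_of_ne hr with hr | hr
    · refine ae_isBigO_of_recursion hh hZ (a := ‖r‖) (b := 2) (e := 1) (by simp)
        (norm_nonneg r) hr (by norm_num) fun w R hR hW t => ?_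
      have h1 := hW (t + 1)
      rw [aeval_X_sub_C_apply, add_sub_cancel_right] at h1
      have h2 := hh.2 t 1
      have h3 := norm_add_le (Z w t - r * Z w (t + 1)) (r * Z w (t + 1))
      rw [sub_add_cancel, norm_mul] at h3
      norm_num at h2
      have := mul_le_mul_of_nonneg_left h2 hR
      linarith
    · have hr0 : 0 < ‖r‖ := by linarith
      have hi1 : ‖r‖⁻¹ < 1 := inv_lt_one_of_one_lt₀ hr
      refine ae_isBigO_of_recursion hh hZ (a := ‖r‖⁻¹) (b := 1) (e := -1) (by simp)
        (by positivity) hi1 zero_le_one fun w R hR hW t => ?_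
      have h1 := hW t
      rw [aeval_X_sub_C_apply] at h1
      have h2 : ‖r‖ * ‖Z w t‖ ≤ ‖Z w (t - 1)‖ + R * h t := by
        rw [← norm_mul]
        have := norm_sub_le (Z w (t - 1)) (Z w (t - 1) - r * Z w t)
        rw [sub_sub_cancel] at this
        linarith
      have h3 : ‖Z w t‖ ≤ ‖r‖⁻¹ * (‖Z w (t - 1)‖ + R * h t) := by
        rw [← div_eq_inv_mul, le_div_iff₀ hr0]; linarith
      have h4 : ‖r‖⁻¹ * (R * h t) ≤ 1 * (R * h t) :=
        mul_le_mul_of_nonneg_right hi1.le (mul_nonneg hR (hh.1 t))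
      rw [← sub_eq_add_neg]
      linarith
  have multi : ∀ s : Multiset ℂ, (∀ r ∈ s, ‖r‖ ≠ 1) → ∀ Z : Ω → ℤ → ℂ,
      BoundedInProbability μ Z → ∀ᵐ w ∂μ,
        Polynomial.aeval lag (s.map fun r => Polynomial.X - Polynomial.C r).prod (Z w) =O[⊤] h →
        Z w =O[⊤] h := by
    intro s
    induction s using Multiset.induction_on with
    | empty => exact fun _ Z _ => by simp
    | cons r s ih =>
      intro hs Z hZ
      filter_upwards [ih (fun r' hr' => hs r' (Multiset.mem_cons_of_mem hr')) _
        (hZ.aeval_X_sub_C r), single r (hs r (Multiset.mem_cons_self r s)) Z hZ] with w h1 h2 h3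
      rw [Multiset.map_cons, Multiset.prod_cons, mul_comm, map_mul, Module.End.mul_apply] at h3
      exact h2 (h1 h3)
  have hlead : φ.leadingCoeff ≠ 0 := Polynomial.leadingCoeff_ne_zero.2 hφ0
  have hprod := (IsAlgClosed.splits φ).eq_prod_roots
  filter_upwards [multi φ.roots (fun r hr hr1 => hφ r hr1 ((Polynomial.mem_roots hφ0).1 hr)) Z hZ]
    with w hw h1
  refine hw ?_
  rw [hprod, map_mul, Module.End.mul_apply, Polynomial.aeval_C] at h1
  exact (Asymptotics.isBigO_const_smul_left hlead).1 h1

/-- The lag polynomial `1 - c₁ z - … - c_k z^k` as a complex polynomial. -/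
noncomputable def lagPolynomial {k : ℕ} (c : Fin k → ℝ) : Polynomial ℂ :=
  1 - ∑ j : Fin k, Polynomial.C (c j : ℂ) * Polynomial.X ^ ((j : ℕ) + 1)

lemma eval_lagPolynomial {k : ℕ} (c : Fin k → ℝ) (z : ℂ) :
    (lagPolynomial c).eval z = lagPoly c z := by
  simp [lagPolynomial, lagPoly, Polynomial.eval_finsetSum]

lemma lagPolynomial_ne_zero {k : ℕ} (c : Fin k → ℝ) : lagPolynomial c ≠ 0 := by
  intro h
  have := eval_lagPolynomial c 0
  simp [h, lagPoly] at this

lemma aeval_lagPolynomial_ofReal {k : ℕ} (c : Fin k → ℝ) (f : ℤ → ℝ) (t : ℤ) :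
    Polynomial.aeval lag (lagPolynomial c) (fun u => (f u : ℂ)) t
      = ((f t - ∑ j : Fin k, c j * f (t - ((j : ℕ) + 1)) : ℝ) : ℂ) := by
  simp [lagPolynomial, lag_pow_apply, Polynomial.aeval_C, Module.algebraMap_end_apply]

/-! ### The recursions along a single path -/

variable {P Q p q : ℕ}

/-- A path `(y, x, s)` of observations, errors and volatilities that satisfies the ARMA and the
volatility equations at all times. The innovations play no role here. -/
structure IsPath (θ : Param P Q p q) (y x s : ℤ → ℝ) : Prop where
  arma : ∀ t, y t = ∑ j : Fin P, θ.phi j * y (t - ((j : ℕ) + 1))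
    + x t - ∑ j : Fin Q, θ.vartheta j * x (t - ((j : ℕ) + 1))
  nonneg : ∀ t, 0 ≤ s t
  sq : ∀ t, s t ^ 2 = θ.omega + ∑ j : Fin p, θ.alpha j * x (t - ((j : ℕ) + 1)) ^ 2
    + ∑ j : Fin q, θ.beta j * s (t - ((j : ℕ) + 1)) ^ 2

/-- The sequence `z` with its values at nonpositive times replaced by zero. -/
noncomputable def causalPart (z : ℤ → ℝ) (t : ℤ) : ℝ := if t ≤ 0 then 0 else z t

lemma causalPart_of_nonpos (z : ℤ → ℝ) {t : ℤ} (ht : t ≤ 0) : causalPart z t = 0 := if_pos ht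

lemma causalPart_of_pos (z : ℤ → ℝ) {t : ℤ} (ht : 1 ≤ t) : causalPart z t = z t :=
  if_neg (by omega)

lemma xHat_of_nonpos (θ : Param P Q p q) (y : ℤ → ℝ) {t : ℤ} (ht : t ≤ 0) :
    xHat θ y t = 0 := by
  rw [xHat, dif_pos ht]

lemma xHat_of_pos (θ : Param P Q p q) (y : ℤ → ℝ) {t : ℤ} (ht : 1 ≤ t) :
    xHat θ y t = y t - ∑ j : Fin P, θ.phi j * causalPart y (t - ((j : ℕ) + 1))
      + ∑ j : Fin Q, θ.vartheta j * xHat θ y (t - ((j : ℕ) + 1)) := by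
  rw [xHat, dif_neg (by omega)]
  rfl

lemma sigmaHatSq_of_nonpos (θ : Param P Q p q) (y : ℤ → ℝ) {t : ℤ} (ht : t ≤ 0) :
    sigmaHatSq θ y t = 0 := by
  rw [sigmaHatSq, dif_pos ht]

lemma sigmaHatSq_of_pos (θ : Param P Q p q) (y : ℤ → ℝ) {t : ℤ} (ht : 1 ≤ t) :
    sigmaHatSq θ y t = θ.omega + ∑ j : Fin p, θ.alpha j * xHat θ y (t - ((j : ℕ) + 1)) ^ 2
      + ∑ j : Fin q, θ.beta j * sigmaHatSq θ y (t - ((j : ℕ) + 1)) := by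
  rw [sigmaHatSq, dif_neg (by omega)]

lemma Param.abs_phi_le (θ : Param P Q p q) (j : Fin P) : |θ.phi j| ≤ ‖θ‖ :=
  (norm_le_pi_norm θ.1.1 j).trans ((norm_fst_le θ.1).trans (norm_fst_le θ))

lemma Param.abs_vartheta_le (θ : Param P Q p q) (j : Fin Q) : |θ.vartheta j| ≤ ‖θ‖ :=
  (norm_le_pi_norm θ.1.2 j).trans ((norm_snd_le θ.1).trans (norm_fst_le θ))

lemma Param.abs_omega_le (θ : Param P Q p q) : |θ.omega| ≤ ‖θ‖ :=
  (norm_fst_le θ.2).trans (norm_snd_le θ)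

lemma Param.abs_alpha_le (θ : Param P Q p q) (j : Fin p) : |θ.alpha j| ≤ ‖θ‖ :=
  (norm_le_pi_norm θ.2.2.1 j).trans
    ((norm_fst_le θ.2.2).trans ((norm_snd_le θ.2).trans (norm_snd_le θ)))

lemma Param.abs_beta_le (θ : Param P Q p q) (j : Fin q) : |θ.beta j| ≤ ‖θ‖ :=
  (norm_le_pi_norm θ.2.2.2 j).trans
    ((norm_snd_le θ.2.2).trans ((norm_snd_le θ.2).trans (norm_snd_le θ)))

/-- The joint effect, on one summand of a recursion, of replacing the true coefficient by a
coefficient at distance `O(n^{-1/2})` and of setting the past before time `1` to zero. Over the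
times `1, …, n` both effects are at most a constant multiple of the weight `(1 + t) ^ (-γ)`. -/
lemma abs_coef_mul_causalPart_sub_le {γ : ℝ} (hγ0 : 0 ≤ γ) (hγ1 : γ ≤ 1 / 2)
    {a a₀ A R η : ℝ} {z : ℤ → ℝ} {n m : ℕ} {t k : ℤ} (hA : |a₀| ≤ A) (hR : 0 ≤ R)
    (hη : √(n : ℝ) * |a - a₀| ≤ η) (ht1 : 1 ≤ t) (htn : t ≤ n) (hk1 : 1 ≤ k) (hkm : k ≤ m)
    (hz : |z (t - k)| ≤ R * weight (1 / 2 - γ) (t - k)) :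
    |a * causalPart z (t - k) - a₀ * z (t - k)|
      ≤ (2 * η + A * (1 + m)) * R * weight (-γ) t := by
  have hη0 : 0 ≤ η := le_trans (by positivity) hη
  have hA0 : 0 ≤ A := (abs_nonneg _).trans hA
  have hw := weight_pos (-γ) t
  rcases le_or_gt (t - k) 0 with h | h
  · rw [causalPart_of_nonpos z h, mul_zero, zero_sub, abs_neg, abs_mul]
    have h1 : weight (1 / 2 - γ) (t - k) ≤ (1 + m) * weight (-γ) t := by
      refine (weight_half_sub_le hγ0 hγ1 (M := m) (t := t) ?_ ?_).trans ?_
      · have : |t - k| ≤ m := by rw [abs_le]; omega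
        exact_mod_cast this
      · have : |t| ≤ m := by rw [abs_le]; omega
        exact_mod_cast this
      · gcongr
        refine (Real.sqrt_le_left (by positivity)).2 ?_
        nlinarith [(Nat.cast_nonneg m : (0 : ℝ) ≤ m)]
    calc |a₀| * |z (t - k)| ≤ A * (R * ((1 + m) * weight (-γ) t)) := by
          gcongr; exact hz.trans (by gcongr)
      _ ≤ _ := by
          have : 0 ≤ 2 * η * R * weight (-γ) t := by positivity
          nlinarith
  · rw [causalPart_of_pos z (by omega), ← sub_mul, abs_mul]
    have h1 : weight (1 / 2 - γ) (t - k) ≤ 2 * √(n : ℝ) * weight (-γ) t :=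
      weight_half_sub_le_sqrt hγ0 hγ1 (by omega) (by rw [abs_le]; omega) (by rw [abs_le]; omega)
    calc |a - a₀| * |z (t - k)| ≤ |a - a₀| * (R * (2 * √(n : ℝ) * weight (-γ) t)) := by
          gcongr; exact hz.trans (by gcongr)
      _ = (√(n : ℝ) * |a - a₀|) * (2 * R * weight (-γ) t) := by ring
      _ ≤ η * (2 * R * weight (-γ) t) := by gcongr
      _ ≤ _ := by
          have : 0 ≤ A * (1 + m) * R * weight (-γ) t := by positivity
          nlinarith

lemma eventually_le_mul_sqrt (a : ℝ) {b : ℝ} (hb : 0 < b) : ∀ᶠ n : ℕ in atTop, a ≤ b * √(n : ℝ) :=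
  ((Real.tendsto_sqrt_atTop.comp tendsto_natCast_atTop_atTop).const_mul_atTop hb).eventually_ge_atTop
    a

/-! ### Estimated ARMA errors -/

/-- Uniformly over parameters within `O(n^{-1/2})` of the true one, the estimated ARMA errors
differ from the true ones by at most a multiple of `(1 + t) ^ (-γ)`, along paths that grow at most
like `(1 + |t|) ^ (1 / 2 - γ)`. -/
lemma exists_abs_xHat_sub_le {θ₀ : Param P Q p q}
    (hvartheta : ∀ z : ℂ, ‖z‖ ≤ 1 → lagPoly θ₀.vartheta z ≠ 0)
    {γ : ℝ} (hγ0 : 0 ≤ γ) (hγ1 : γ ≤ 1 / 2) {η R : ℝ} (hη : 0 ≤ η) (hR : 0 ≤ R) :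
    ∃ C : ℝ, 0 ≤ C ∧ ∀ᶠ n : ℕ in atTop, ∀ y x s : ℤ → ℝ, IsPath θ₀ y x s →
      (∀ t, |y t| ≤ R * weight (1 / 2 - γ) t) → (∀ t, |x t| ≤ R * weight (1 / 2 - γ) t) →
      ∀ θ : Param P Q p q, √(n : ℝ) * ‖θ - θ₀‖ ≤ η →
      ∀ t : ℤ, t ≤ n → |causalPart (fun u => xHat θ y u - x u) t| ≤ C * weight (-γ) t := by
  have hmod : Moderate (weight (-γ)) :=
    moderate_weight (by rw [abs_neg, abs_of_nonneg hγ0]; linarith)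
  obtain ⟨C, hC, hcausal⟩ := exists_causal_bound hmod (lagPolynomial_ne_zero θ₀.vartheta)
    fun z hz => by rw [eval_lagPolynomial]; exact hvartheta z hz
  set m : ℕ := P + Q with hm
  set W : ℝ := weight γ m with hW
  have hW0 : 0 < W := weight_pos _ _
  set B : ℝ := (2 * η + ‖θ₀‖ * (1 + m)) * R with hB
  have hB0 : 0 ≤ B := by positivity
  set F : ℝ := (P + Q) * B with hF
  have hF0 : 0 ≤ F := by positivity
  refine ⟨2 * C * F, by positivity, ?_⟩
  filter_upwards [eventually_le_mul_sqrt (2 * C * (Q * η * W)) one_pos, eventually_ge_atTop 1]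
    with n hn hn1 y x s hpath hy hx θ hθ
  set D : ℤ → ℝ := causalPart fun u => xHat θ y u - x u with hD
  have hDneg : ∀ t ≤ 0, D t = 0 := fun t ht => causalPart_of_nonpos _ ht
  have hn0 : 0 < √(n : ℝ) := Real.sqrt_pos.2 (by exact_mod_cast hn1)
  -- the equation satisfied by the difference of the estimated and the true errors
  have hDeq : ∀ t, 1 ≤ t → D t - ∑ j : Fin Q, θ₀.vartheta j * D (t - ((j : ℕ) + 1))
      = ∑ j : Fin Q, (θ.vartheta j - θ₀.vartheta j) * D (t - ((j : ℕ) + 1))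
      + ∑ j : Fin Q, (θ.vartheta j * causalPart x (t - ((j : ℕ) + 1))
          - θ₀.vartheta j * x (t - ((j : ℕ) + 1)))
      - ∑ j : Fin P, (θ.phi j * causalPart y (t - ((j : ℕ) + 1))
          - θ₀.phi j * y (t - ((j : ℕ) + 1))) := by
    intro t ht
    have hx' : ∀ u, xHat θ y u = causalPart x u + D u := by
      intro u
      rcases le_or_gt u 0 with hu | hu
      · rw [xHat_of_nonpos θ y hu, causalPart_of_nonpos x hu, hDneg u hu, add_zero]
      · rw [hD, causalPart_of_pos _ hu, causalPart_of_pos _ hu]; ring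
    have h1 : D t = xHat θ y t - x t := causalPart_of_pos _ ht
    have h2 := hpath.arma t
    rw [h1, xHat_of_pos θ y ht]
    simp only [hx', sub_mul, mul_add, Finset.sum_sub_distrib, Finset.sum_add_distrib]
    linarith
  -- induction over the time horizon: the terms with `θ.vartheta - θ₀.vartheta` involve only
  -- earlier values of `D` and are absorbed, their coefficients being `O(n^{-1/2})`
  have hstep : ∀ N : ℕ, N ≤ n → ∀ t : ℤ, t ≤ N → |D t| ≤ 2 * C * F * weight (-γ) t := by
    intro N
    induction N with
    | zero =>
      intro _ t ht
      rw [hDneg t (by simpa using ht), abs_zero]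
      have := weight_pos (-γ) t
      positivity
    | succ N ih =>
      intro hN t ht
      have ih := ih (by omega)
      set κ : ℝ := Q * (η / √(n : ℝ)) * W with hκ
      have hκ0 : 0 ≤ κ := by positivity
      have hCκ : C * κ ≤ 1 / 2 := by
        have : C * κ = (2 * C * (Q * η * W)) / √(n : ℝ) / 2 := by rw [hκ]; ring
        rw [this]
        have : 2 * C * (Q * η * W) / √(n : ℝ) ≤ 1 := by
          rw [div_le_one hn0]; linarith
        linarith
      have h := hcausal (fun u => (D u : ℂ)) (N + 1 : ℕ) (F + κ * (2 * C * F)) (by positivity)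
        (fun u hu => by simp [hDneg u hu]) ?_ t ht
      · rw [Complex.norm_real, Real.norm_eq_abs] at h
        refine h.trans (mul_le_mul_of_nonneg_right ?_ (weight_pos _ _).le)
        have := mul_le_mul_of_nonneg_right hCκ (by positivity : 0 ≤ 2 * C * F)
        linarith
      · intro u hu
        rw [aeval_lagPolynomial_ofReal, Complex.norm_real, Real.norm_eq_abs]
        have hwu := weight_pos (-γ) u
        rcases le_or_gt u 0 with hu0 | hu0
        · rw [hDneg u hu0, Finset.sum_eq_zero fun j _ => by rw [hDneg _ (by omega), mul_zero]]
          rw [sub_zero, abs_zero]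
          positivity
        · rw [hDeq u hu0]
          have hun : u ≤ n := by push_cast at hu; omega
          have b1 : |∑ j : Fin Q, (θ.vartheta j - θ₀.vartheta j) * D (u - ((j : ℕ) + 1))|
              ≤ Q * (η / √(n : ℝ) * (2 * C * F * (W * weight (-γ) u))) := by
            refine (Finset.abs_sum_le_sum_abs _ _).trans ?_
            refine (Finset.sum_le_card_nsmul _ _
              (η / √(n : ℝ) * (2 * C * F * (W * weight (-γ) u))) fun j _ => ?_).trans (by simp)
            rw [abs_mul]
            have e1 : |θ.vartheta j - θ₀.vartheta j| ≤ η / √(n : ℝ) := by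
              rw [le_div_iff₀ hn0, mul_comm]
              refine le_trans ?_ hθ
              gcongr
              exact (θ - θ₀).abs_vartheta_le j
            have e2 : |D (u - ((j : ℕ) + 1))| ≤ 2 * C * F * (W * weight (-γ) u) := by
              refine (ih _ (by push_cast at hu; omega)).trans ?_
              gcongr
              exact weight_sub_le hγ0 (by rw [abs_le]; omega)
            gcongr
          have b2 : |∑ j : Fin Q, (θ.vartheta j * causalPart x (u - ((j : ℕ) + 1))
              - θ₀.vartheta j * x (u - ((j : ℕ) + 1)))| ≤ Q * (B * weight (-γ) u) := by
            refine (Finset.abs_sum_le_sum_abs _ _).trans ?_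
            refine (Finset.sum_le_card_nsmul _ _ (B * weight (-γ) u) fun j _ => ?_).trans (by simp)
            refine abs_coef_mul_causalPart_sub_le hγ0 hγ1 (n := n) (θ₀.abs_vartheta_le j) hR ?_
              hu0 hun (by omega) (by omega) (hx _)
            refine le_trans ?_ hθ
            gcongr
            exact (θ - θ₀).abs_vartheta_le j
          have b3 : |∑ j : Fin P, (θ.phi j * causalPart y (u - ((j : ℕ) + 1))
              - θ₀.phi j * y (u - ((j : ℕ) + 1)))| ≤ P * (B * weight (-γ) u) := by
            refine (Finset.abs_sum_le_sum_abs _ _).trans ?_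
            refine (Finset.sum_le_card_nsmul _ _ (B * weight (-γ) u) fun j _ => ?_).trans (by simp)
            refine abs_coef_mul_causalPart_sub_le hγ0 hγ1 (n := n) (θ₀.abs_phi_le j) hR ?_
              hu0 hun (by omega) (by omega) (hy _)
            refine le_trans ?_ hθ
            gcongr
            exact (θ - θ₀).abs_phi_le j
          refine (abs_sub _ _).trans ((add_le_add (abs_add_le _ _) le_rfl).trans ?_)
          rw [hF, hκ]
          linarith
  exact hstep n le_rfl

/-! ### Estimated volatilities and residuals -/

namespace IsPath

variable {θ₀ : Param P Q p q} {y x s : ℤ → ℝ}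

lemma omega_le_sq (h : IsPath θ₀ y x s) (hα : ∀ j, 0 ≤ θ₀.alpha j) (hβ : ∀ j, 0 ≤ θ₀.beta j)
    (t : ℤ) : θ₀.omega ≤ s t ^ 2 := by
  have h1 := h.sq t
  have h2 : 0 ≤ ∑ j : Fin p, θ₀.alpha j * x (t - ((j : ℕ) + 1)) ^ 2 :=
    Finset.sum_nonneg fun j _ => mul_nonneg (hα j) (sq_nonneg _)
  have h3 : 0 ≤ ∑ j : Fin q, θ₀.beta j * s (t - ((j : ℕ) + 1)) ^ 2 :=
    Finset.sum_nonneg fun j _ => mul_nonneg (hβ j) (sq_nonneg _)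
  linarith

lemma alpha_mul_sq_le_sq (h : IsPath θ₀ y x s) (hω : 0 ≤ θ₀.omega) (hα : ∀ j, 0 ≤ θ₀.alpha j)
    (hβ : ∀ j, 0 ≤ θ₀.beta j) (t : ℤ) (i : Fin p) :
    θ₀.alpha i * x (t - ((i : ℕ) + 1)) ^ 2 ≤ s t ^ 2 := by
  have h1 := h.sq t
  have h2 := Finset.single_le_sum (f := fun j : Fin p => θ₀.alpha j * x (t - ((j : ℕ) + 1)) ^ 2)
    (fun j _ => mul_nonneg (hα j) (sq_nonneg _)) (Finset.mem_univ i)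
  have h3 : 0 ≤ ∑ j : Fin q, θ₀.beta j * s (t - ((j : ℕ) + 1)) ^ 2 :=
    Finset.sum_nonneg fun j _ => mul_nonneg (hβ j) (sq_nonneg _)
  linarith

lemma sum_beta_mul_sq_le_sq (h : IsPath θ₀ y x s) (hω : 0 ≤ θ₀.omega)
    (hα : ∀ j, 0 ≤ θ₀.alpha j) (t : ℤ) :
    ∑ j : Fin q, θ₀.beta j * s (t - ((j : ℕ) + 1)) ^ 2 ≤ s t ^ 2 := by
  have h1 := h.sq t
  have h2 : 0 ≤ ∑ j : Fin p, θ₀.alpha j * x (t - ((j : ℕ) + 1)) ^ 2 :=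
    Finset.sum_nonneg fun j _ => mul_nonneg (hα j) (sq_nonneg _)
  linarith

lemma beta_mul_sq_le_sq (h : IsPath θ₀ y x s) (hω : 0 ≤ θ₀.omega) (hα : ∀ j, 0 ≤ θ₀.alpha j)
    (hβ : ∀ j, 0 ≤ θ₀.beta j) (t : ℤ) (i : Fin q) :
    θ₀.beta i * s (t - ((i : ℕ) + 1)) ^ 2 ≤ s t ^ 2 :=
  (Finset.single_le_sum (f := fun j : Fin q => θ₀.beta j * s (t - ((j : ℕ) + 1)) ^ 2)
    (fun j _ => mul_nonneg (hβ j) (sq_nonneg _)) (Finset.mem_univ i)).trans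
    (h.sum_beta_mul_sq_le_sq hω hα t)

/-- By the Cauchy–Schwarz inequality, the lagged volatilities are contracted when averaged with the
weights `β`. This is why errors are measured relative to `s t` rather than to `s t ^ 2`. -/
lemma sum_beta_mul_le (h : IsPath θ₀ y x s) (hω : 0 ≤ θ₀.omega) (hα : ∀ j, 0 ≤ θ₀.alpha j)
    (hβ : ∀ j, 0 ≤ θ₀.beta j) (t : ℤ) :
    ∑ j : Fin q, θ₀.beta j * s (t - ((j : ℕ) + 1)) ≤ √(∑ j, θ₀.beta j) * s t := by
  have hb : 0 ≤ ∑ j, θ₀.beta j := Finset.sum_nonneg fun j _ => hβ j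
  refine abs_le_of_sq_le_sq' ?_ (mul_nonneg (Real.sqrt_nonneg _) (h.nonneg t)) |>.2
  rw [mul_pow, Real.sq_sqrt hb]
  refine le_trans ?_ (mul_le_mul_of_nonneg_left (h.sum_beta_mul_sq_le_sq hω hα t) hb)
  refine Finset.sum_sq_le_sum_mul_sum_of_sq_le_mul _ (fun j _ => hβ j)
    (fun j _ => mul_nonneg (hβ j) (sq_nonneg _)) fun j _ => ?_
  exact le_of_eq (by ring)

/-- The volatility inherits the polynomial growth of the errors. -/
lemma exists_le_weight (h : IsPath θ₀ y x s) (hω : 0 ≤ θ₀.omega) (hα : ∀ j, 0 ≤ θ₀.alpha j)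
    (hβ : ∀ j, 0 ≤ θ₀.beta j) (hβ1 : ∑ j, θ₀.beta j < 1) {c : ℝ} (hc0 : 0 ≤ c) (hc1 : c ≤ 1)
    {R : ℝ} (hR : 0 ≤ R) (hx : ∀ t, |x t| ≤ R * weight c t) {m : ℕ} (hpm : p ≤ m) (hqm : q ≤ m) :
    ∃ S : ℝ, 0 ≤ S ∧ ∀ t : ℤ, -m ≤ t → s t ≤ S * weight c t := by
  set b := ∑ j, θ₀.beta j with hb
  set a : ℝ := θ₀.omega + (∑ j, θ₀.alpha j) * (R * (1 + m)) ^ 2 with ha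
  have hsα : 0 ≤ ∑ j, θ₀.alpha j := Finset.sum_nonneg fun j _ => hα j
  have ha0 : 0 ≤ a := by positivity
  have hb1 : 0 < 1 - b := by linarith
  set S₀ : ℝ := ∑ u ∈ Finset.Icc (-m : ℤ) 0, s u ^ 2 with hS₀
  have hS₀0 : 0 ≤ S₀ := Finset.sum_nonneg fun _ _ => sq_nonneg _
  -- the fixed point `a / (1 - b)` of the recursive bound, enlarged by the initial values
  set S : ℝ := a / (1 - b) + S₀ with hS
  have hS0 : 0 ≤ S := by positivity
  have haS : a + b * S ≤ S := by
    have : a / (1 - b) * (1 - b) = a := div_mul_cancel₀ _ hb1.ne'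
    have : 0 ≤ S₀ * (1 - b) := by positivity
    nlinarith
  have key : ∀ N : ℕ, ∀ t : ℤ, -m ≤ t → t ≤ N → s t ^ 2 ≤ S * weight c (max t 0) ^ 2 := by
    intro N
    induction N with
    | zero =>
      intro t ht1 ht2
      have ht2' : t ≤ 0 := by simpa using ht2
      have h1 := Finset.single_le_sum (f := fun u => s u ^ 2) (fun _ _ => sq_nonneg _)
        (Finset.mem_Icc.2 ⟨ht1, ht2'⟩)
      have h2 : 0 ≤ a / (1 - b) := by positivity
      rw [max_eq_right ht2']
      simp only [weight, Int.cast_zero, abs_zero, add_zero, Real.one_rpow, one_pow, mul_one]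
      linarith
    | succ N ih =>
      intro t ht1 ht2
      rcases le_or_gt t N with htN | htN
      · exact ih t ht1 htN
      · have ht : 1 ≤ t := by omega
        rw [max_eq_left (by omega)]
        have hw := one_le_weight hc0 t
        have hw2 : 1 ≤ weight c t ^ 2 := one_le_pow₀ hw
        rw [h.sq t]
        have h1 : ∑ j : Fin p, θ₀.alpha j * x (t - ((j : ℕ) + 1)) ^ 2
            ≤ (∑ j, θ₀.alpha j) * ((R * (1 + m)) ^ 2 * weight c t ^ 2) := by
          rw [Finset.sum_mul]
          refine Finset.sum_le_sum fun j _ => mul_le_mul_of_nonneg_left ?_ (hα j)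
          rw [← mul_pow]
          refine sq_le_sq' ?_ ?_
          all_goals
            have h2 : weight c (t - ((j : ℕ) + 1)) ≤ (1 + m) * weight c t := by
              have := (moderate_weight (c := c) (by rwa [abs_of_nonneg hc0])).2 t
                (-((j : ℕ) + 1))
              rw [← sub_eq_add_neg] at this
              refine this.trans (mul_le_mul_of_nonneg_right ?_ (weight_pos _ _).le)
              have : |(-((j : ℕ) + 1) : ℤ)| ≤ m := by rw [abs_le]; omega
              have : |((-((j : ℕ) + 1) : ℤ) : ℝ)| ≤ m := by exact_mod_cast this
              linarith
            have h3 : |x (t - ((j : ℕ) + 1))| ≤ R * (1 + m) * weight c t :=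
              (hx _).trans (by rw [mul_assoc]; gcongr)
            have := abs_le.1 h3
            linarith
        have h2 : ∑ j : Fin q, θ₀.beta j * s (t - ((j : ℕ) + 1)) ^ 2
            ≤ b * (S * weight c t ^ 2) := by
          rw [hb, Finset.sum_mul]
          refine Finset.sum_le_sum fun j _ => mul_le_mul_of_nonneg_left ?_ (hβ j)
          refine (ih _ (by omega) (by push_cast at ht2; omega)).trans ?_
          have := (weight_pos c (max (t - ((j : ℕ) + 1)) 0)).le
          have : weight c (max (t - ((j : ℕ) + 1)) 0) ≤ weight c t :=
            weight_mono hc0 (by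
              rw [abs_of_nonneg (le_max_right _ _), abs_of_nonneg (by omega)]; omega)
          gcongr
        have h3 := mul_le_mul_of_nonneg_right haS (zero_le_one.trans hw2)
        have h4 : θ₀.omega * 1 ≤ θ₀.omega * weight c t ^ 2 := by gcongr
        rw [ha] at h3
        linarith
  refine ⟨√S, Real.sqrt_nonneg _, fun t ht => ?_⟩
  refine abs_le_of_sq_le_sq' ?_ (mul_nonneg (Real.sqrt_nonneg _) (weight_pos _ _).le) |>.2
  rw [mul_pow, Real.sq_sqrt hS0]
  refine (key t.toNat t ht (by omega)).trans ?_
  have := (weight_pos c (max t 0)).le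
  have : weight c (max t 0) ≤ weight c t :=
    weight_mono hc0 (by
      rw [abs_of_nonneg (le_max_right _ _)]; exact max_le (le_abs_self _) (abs_nonneg _))
  gcongr

end IsPath

/-- Uniformly over parameters within `O(n^{-1/2})` of the true one, the estimated variances
differ from the true ones by at most a multiple of `(1 + t) ^ (-γ) * s t`. -/
lemma exists_abs_sigmaHatSq_sub_le {θ₀ : Param P Q p q} (hω : 0 < θ₀.omega)
    (hα : ∀ j, 0 < θ₀.alpha j) (hβ : ∀ j, 0 < θ₀.beta j)
    {γ : ℝ} (hγ0 : 0 ≤ γ) (hγ1 : γ ≤ 1 / 2) {m : ℕ} (hpm : p ≤ m) (hqm : q ≤ m)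
    (hcontr : √(∑ j, θ₀.beta j) * weight γ m < 1)
    {η R d : ℝ} (hη : 0 ≤ η) (hR : 0 ≤ R) (hd : 0 ≤ d) :
    ∃ C : ℝ, 0 ≤ C ∧ ∀ᶠ n : ℕ in atTop, ∀ y x s : ℤ → ℝ, IsPath θ₀ y x s →
      (∀ t, |x t| ≤ R * weight (1 / 2 - γ) t) →
      (∀ t : ℤ, -m ≤ t → s t ≤ R * weight (1 / 2 - γ) t) →
      ∀ θ : Param P Q p q, (∀ j, 0 ≤ θ.alpha j) → (∀ j, 0 ≤ θ.beta j) →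
      √(n : ℝ) * ‖θ - θ₀‖ ≤ η →
      (∀ t : ℤ, t ≤ n → |causalPart (fun u => xHat θ y u - x u) t| ≤ d * weight (-γ) t) →
      ∀ t : ℤ, 1 ≤ t → t ≤ n → |sigmaHatSq θ y t - s t ^ 2| ≤ C * weight (-γ) t * s t := by
  have hα0 : ∀ j, 0 ≤ θ₀.alpha j := fun j => (hα j).le
  have hβ0 : ∀ j, 0 ≤ θ₀.beta j := fun j => (hβ j).le
  set W : ℝ := weight γ m with hW
  have hW0 : 0 < W := weight_pos _ _
  set b : ℝ := √(∑ j, θ₀.beta j) with hb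
  have hb0 : 0 ≤ b := Real.sqrt_nonneg _
  -- room in the contraction for replacing `β₀` by `β`
  obtain ⟨l, hl1, hl⟩ : ∃ l : ℝ, 1 < l ∧ l * (b * W) < 1 := by
    have hc : Tendsto (fun l : ℝ => l * (b * W)) (𝓝[>] 1) (𝓝 (1 * (b * W))) :=
      ((continuous_id.mul continuous_const).tendsto (1 : ℝ)).mono_left nhdsWithin_le_nhds
    rw [one_mul] at hc
    obtain ⟨l, h1, h2⟩ := ((hc.eventually_lt_const hcontr).and self_mem_nhdsWithin).exists
    exact ⟨l, h2, h1⟩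
  -- with such an `L`, each lagged error, each lagged volatility and `1` are at most `L * s t`
  obtain ⟨L, hL0, hLω, hLα, hLβ⟩ : ∃ L : ℝ, 0 ≤ L ∧ 1 ≤ L ^ 2 * θ₀.omega ∧
      (∀ j, 1 ≤ L ^ 2 * θ₀.alpha j) ∧ ∀ j, 1 ≤ L ^ 2 * θ₀.beta j := by
    have hev : ∀ {a : ℝ}, 0 < a → ∀ᶠ L : ℝ in atTop, 1 ≤ L ^ 2 * a := fun ha =>
      ((tendsto_pow_atTop two_ne_zero).atTop_mul_const ha).eventually_ge_atTop 1
    exact ((eventually_ge_atTop 0).and ((hev hω).and ((eventually_all.2 fun j => hev (hα j)).and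
      (eventually_all.2 fun j => hev (hβ j))))).exists
  set B : ℝ := (2 * η + ‖θ₀‖ * (1 + m)) * R with hB
  have hB0 : 0 ≤ B := by positivity
  set A : ℝ := ‖θ₀‖ + η with hA
  have hA0 : 0 ≤ A := by positivity
  set d' : ℝ := d * W with hd'
  have hd'0 : 0 ≤ d' := by positivity
  set g : ℝ := 2 * η * L + p * (B * L + A * (2 * L * d' + d' ^ 2 * L)) + q * (B * L) with hg
  have hg0 : 0 ≤ g := by positivity
  have hl' : 0 < 1 - l * (b * W) := by linarith
  set M : ℝ := g / (1 - l * (b * W)) with hM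
  have hM0 : 0 ≤ M := by positivity
  have hgM : g + l * (b * W) * M = M := by
    have : M * (1 - l * (b * W)) = g := div_mul_cancel₀ _ hl'.ne'
    linarith
  refine ⟨M, hM0, ?_⟩
  filter_upwards [eventually_ge_atTop 1, eventually_all.2 fun j : Fin q =>
    eventually_le_mul_sqrt η (mul_pos (sub_pos.2 hl1) (hβ j))] with
    n hn1 hnβ y x s hpath hx hs θ hθα hθβ hθ hD
  have hn0 : 0 < √(n : ℝ) := Real.sqrt_pos.2 (by exact_mod_cast hn1)
  have hn1' : 1 ≤ √(n : ℝ) := Real.one_le_sqrt.2 (by exact_mod_cast hn1)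
  have hcoef : ∀ {a : ℝ}, |a| ≤ ‖θ - θ₀‖ → √(n : ℝ) * |a| ≤ η := fun h =>
    (mul_le_mul_of_nonneg_left h hn0.le).trans hθ
  set D : ℤ → ℝ := causalPart fun u => xHat θ y u - x u with hDdef
  set E : ℤ → ℝ := causalPart fun u => sigmaHatSq θ y u - s u ^ 2 with hE
  have hx' : ∀ u, xHat θ y u = causalPart x u + D u := by
    intro u
    rcases le_or_gt u 0 with hu | hu
    · rw [xHat_of_nonpos θ y hu, causalPart_of_nonpos x hu, hDdef, causalPart_of_nonpos _ hu,
        add_zero]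
    · rw [hDdef, causalPart_of_pos _ hu, causalPart_of_pos _ hu]; ring
  have hs' : ∀ u, sigmaHatSq θ y u = causalPart s u * s u + E u := by
    intro u
    rcases le_or_gt u 0 with hu | hu
    · rw [sigmaHatSq_of_nonpos θ y hu, causalPart_of_nonpos s hu, hE, causalPart_of_nonpos _ hu]
      ring
    · rw [hE, causalPart_of_pos _ hu, causalPart_of_pos _ hu]; ring
  have habs : ∀ u, |causalPart x u| ≤ |x u| := by
    intro u
    unfold causalPart
    split_ifs <;> simp
  have hsq : ∀ u, causalPart x u ^ 2 = causalPart x u * x u := by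
    intro u
    unfold causalPart
    split_ifs <;> ring
  have hEeq : ∀ t, 1 ≤ t → E t = (θ.omega - θ₀.omega)
      + ∑ j : Fin p, ((θ.alpha j * causalPart x (t - ((j : ℕ) + 1))
          - θ₀.alpha j * x (t - ((j : ℕ) + 1))) * x (t - ((j : ℕ) + 1))
        + θ.alpha j * (2 * causalPart x (t - ((j : ℕ) + 1)) * D (t - ((j : ℕ) + 1))
          + D (t - ((j : ℕ) + 1)) ^ 2))
      + ∑ j : Fin q, ((θ.beta j * causalPart s (t - ((j : ℕ) + 1))
          - θ₀.beta j * s (t - ((j : ℕ) + 1))) * s (t - ((j : ℕ) + 1)))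
      + ∑ j : Fin q, θ.beta j * E (t - ((j : ℕ) + 1)) := by
    intro t ht
    have h1 : E t = sigmaHatSq θ y t - s t ^ 2 := causalPart_of_pos _ ht
    have e1 : ∀ j : Fin p, (θ.alpha j * causalPart x (t - ((j : ℕ) + 1))
          - θ₀.alpha j * x (t - ((j : ℕ) + 1))) * x (t - ((j : ℕ) + 1))
        + θ.alpha j * (2 * causalPart x (t - ((j : ℕ) + 1)) * D (t - ((j : ℕ) + 1))
          + D (t - ((j : ℕ) + 1)) ^ 2)
        = θ.alpha j * xHat θ y (t - ((j : ℕ) + 1)) ^ 2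
          - θ₀.alpha j * x (t - ((j : ℕ) + 1)) ^ 2 := by
      intro j
      rw [hx', add_sq, hsq]; ring
    have e2 : ∀ j : Fin q, (θ.beta j * causalPart s (t - ((j : ℕ) + 1))
          - θ₀.beta j * s (t - ((j : ℕ) + 1))) * s (t - ((j : ℕ) + 1))
        = θ.beta j * sigmaHatSq θ y (t - ((j : ℕ) + 1))
          - θ₀.beta j * s (t - ((j : ℕ) + 1)) ^ 2 - θ.beta j * E (t - ((j : ℕ) + 1)) := by
      intro j
      rw [hs']; ring
    rw [h1, sigmaHatSq_of_pos θ y ht, hpath.sq t]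
    simp only [e1, e2, Finset.sum_sub_distrib]
    ring
  have hle : ∀ {a v : ℝ} {t : ℤ}, 0 ≤ v → 1 ≤ L ^ 2 * a → a * v ^ 2 ≤ s t ^ 2 → v ≤ L * s t := by
    intro a v t hv ha hav
    refine abs_le_of_sq_le_sq' ?_ (mul_nonneg hL0 (hpath.nonneg t)) |>.2
    rw [mul_pow]
    have := mul_le_mul_of_nonneg_left hav (sq_nonneg L)
    have := mul_le_mul_of_nonneg_right ha (sq_nonneg v)
    linarith
  have hstep : ∀ N : ℕ, N ≤ n → ∀ t : ℤ, t ≤ N → |E t| ≤ M * weight (-γ) t * s t := by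
    intro N
    induction N with
    | zero =>
      intro _ t ht
      rw [hE, causalPart_of_nonpos _ (by simpa using ht), abs_zero]
      exact mul_nonneg (mul_nonneg hM0 (weight_pos _ _).le) (hpath.nonneg t)
    | succ N ih =>
      intro hN t ht
      have ih := ih (by omega)
      rcases le_or_gt t N with htN | htN
      · exact ih t htN
      have ht1 : 1 ≤ t := by omega
      have htn : t ≤ n := by push_cast at ht; omega
      set h := weight (-γ) t with hh
      have hh0 : 0 < h := weight_pos _ _
      have hh1 : h ≤ 1 := weight_neg_le_one hγ0 t
      have hst := hpath.nonneg t
      have h1s : 1 ≤ L * s t := by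
        refine hle (a := θ₀.omega) zero_le_one hLω ?_
        rw [one_pow, mul_one]
        exact hpath.omega_le_sq hα0 hβ0 t
      have hxs : ∀ j : Fin p, |x (t - ((j : ℕ) + 1))| ≤ L * s t := fun j =>
        hle (abs_nonneg _) (hLα j)
          (by rw [sq_abs]; exact hpath.alpha_mul_sq_le_sq hω.le hα0 hβ0 t j)
      have hss : ∀ j : Fin q, s (t - ((j : ℕ) + 1)) ≤ L * s t := fun j =>
        hle (hpath.nonneg _) (hLβ j) (hpath.beta_mul_sq_le_sq hω.le hα0 hβ0 t j)
      have b1 : |θ.omega - θ₀.omega| ≤ 2 * η * L * (h * s t) := by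
        have h1 := hcoef ((θ - θ₀).abs_omega_le)
        have h2 : (1 : ℝ) ≤ 2 * √(n : ℝ) * h :=
          (one_le_weight (by linarith) 0).trans
            (weight_half_sub_le_sqrt hγ0 hγ1 (u := 0) hn1 (by simp) (by rw [abs_le]; omega))
        calc |θ.omega - θ₀.omega| = |θ.omega - θ₀.omega| * 1 * 1 := by ring
          _ ≤ |θ.omega - θ₀.omega| * (2 * √(n : ℝ) * h) * (L * s t) := by gcongr
          _ = (√(n : ℝ) * |(θ - θ₀).omega|) * (2 * h * (L * s t)) := by
              rw [show (θ - θ₀).omega = θ.omega - θ₀.omega from rfl]; ring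
          _ ≤ η * (2 * h * (L * s t)) := by gcongr
          _ = _ := by ring
      have b2 : |∑ j : Fin p, ((θ.alpha j * causalPart x (t - ((j : ℕ) + 1))
          - θ₀.alpha j * x (t - ((j : ℕ) + 1))) * x (t - ((j : ℕ) + 1))
        + θ.alpha j * (2 * causalPart x (t - ((j : ℕ) + 1)) * D (t - ((j : ℕ) + 1))
          + D (t - ((j : ℕ) + 1)) ^ 2))|
          ≤ p * (B * L + A * (2 * L * d' + d' ^ 2 * L)) * (h * s t) := by
        refine (Finset.abs_sum_le_sum_abs _ _).trans ?_
        refine (Finset.sum_le_card_nsmul _ _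
          ((B * L + A * (2 * L * d' + d' ^ 2 * L)) * (h * s t)) fun j _ => ?_).trans
          (le_of_eq (by simp; ring))
        have hc := abs_coef_mul_causalPart_sub_le hγ0 hγ1 (n := n) (m := m) (θ₀.abs_alpha_le j) hR
          (hcoef ((θ - θ₀).abs_alpha_le j)) ht1 htn (k := (j : ℕ) + 1) (by omega) (by omega)
          (hx _)
        have hDj : |D (t - ((j : ℕ) + 1))| ≤ d' * h := by
          refine (hD _ (by omega)).trans ?_
          rw [hd', mul_assoc]
          gcongr
          exact weight_sub_le hγ0 (by rw [abs_le]; omega)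
        have hxj := (habs _).trans (hxs j)
        have hαA : θ.alpha j ≤ A := by
          have h1 := le_of_abs_le ((θ - θ₀).abs_alpha_le j)
          have h2 := le_of_abs_le (θ₀.abs_alpha_le j)
          have h3 : ‖θ - θ₀‖ ≤ η := le_trans (le_mul_of_one_le_left (norm_nonneg _) hn1') hθ
          have h4 : (θ - θ₀).alpha j = θ.alpha j - θ₀.alpha j := rfl
          linarith
        set u := t - ((j : ℕ) + 1)
        refine (abs_add_le _ _).trans ?_
        rw [abs_mul, abs_mul, abs_of_nonneg (hθα j)]
        have c1 : |θ.alpha j * causalPart x u - θ₀.alpha j * x u| * |x u|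
            ≤ B * h * (L * s t) := mul_le_mul hc (hxs j) (abs_nonneg _) (by positivity)
        have c2 : |2 * causalPart x u * D u + D u ^ 2|
            ≤ 2 * (L * s t) * (d' * h) + d' ^ 2 * h * (L * s t) := by
          refine (abs_add_le _ _).trans (add_le_add ?_ ?_)
          · rw [abs_mul, abs_mul, abs_two]
            gcongr
          · rw [abs_of_nonneg (sq_nonneg _), ← sq_abs]
            calc |D u| ^ 2 ≤ (d' * h) ^ 2 := by gcongr
              _ = d' ^ 2 * h * (h * 1) := by ring
              _ ≤ d' ^ 2 * h * (1 * (L * s t)) := by gcongr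
              _ = _ := by ring
        have c3 : θ.alpha j * |2 * causalPart x u * D u + D u ^ 2|
            ≤ A * (2 * (L * s t) * (d' * h) + d' ^ 2 * h * (L * s t)) := by gcongr
        linarith
      have b3 : |∑ j : Fin q, ((θ.beta j * causalPart s (t - ((j : ℕ) + 1))
          - θ₀.beta j * s (t - ((j : ℕ) + 1))) * s (t - ((j : ℕ) + 1)))|
          ≤ q * (B * L) * (h * s t) := by
        refine (Finset.abs_sum_le_sum_abs _ _).trans ?_
        refine (Finset.sum_le_card_nsmul _ _ (B * L * (h * s t)) fun j _ => ?_).trans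
          (le_of_eq (by simp; ring))
        have hc := abs_coef_mul_causalPart_sub_le hγ0 hγ1 (n := n) (m := m) (θ₀.abs_beta_le j) hR
          (hcoef ((θ - θ₀).abs_beta_le j)) ht1 htn (k := (j : ℕ) + 1) (by omega) (by omega)
          (z := s) (by rw [abs_of_nonneg (hpath.nonneg _)]; exact hs _ (by omega))
        rw [abs_mul, abs_of_nonneg (hpath.nonneg (t - ((j : ℕ) + 1)))]
        exact (mul_le_mul hc (hss j) (hpath.nonneg _) (by positivity)).trans
          (le_of_eq (by rw [hB]; ring))
      have b4 : |∑ j : Fin q, θ.beta j * E (t - ((j : ℕ) + 1))|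
          ≤ l * (b * W) * M * (h * s t) := by
        refine (Finset.abs_sum_le_sum_abs _ _).trans ?_
        calc ∑ j : Fin q, |θ.beta j * E (t - ((j : ℕ) + 1))|
            ≤ ∑ j : Fin q, (l * M * W * h) * (θ₀.beta j * s (t - ((j : ℕ) + 1))) := by
              refine Finset.sum_le_sum fun j _ => ?_
              rw [abs_mul, abs_of_nonneg (hθβ j)]
              have e1 : θ.beta j ≤ l * θ₀.beta j := by
                have h1 := hcoef ((θ - θ₀).abs_beta_le j)
                have h2 := (h1.trans (hnβ j))
                rw [mul_comm] at h2
                have h3 := le_of_abs_le (le_of_mul_le_mul_right h2 hn0)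
                have h4 : (θ - θ₀).beta j = θ.beta j - θ₀.beta j := rfl
                linarith
              have e2 : |E (t - ((j : ℕ) + 1))| ≤ M * (W * h) * s (t - ((j : ℕ) + 1)) := by
                refine (ih _ (by push_cast at ht; omega)).trans ?_
                have := hpath.nonneg (t - ((j : ℕ) + 1))
                gcongr
                exact weight_sub_le hγ0 (by rw [abs_le]; omega)
              calc _ ≤ (l * θ₀.beta j) * (M * (W * h) * s (t - ((j : ℕ) + 1))) :=
                    mul_le_mul e1 e2 (abs_nonneg _) (by have := hβ0 j; positivity)
                _ = _ := by ring
          _ = (l * M * W * h) * ∑ j : Fin q, θ₀.beta j * s (t - ((j : ℕ) + 1)) := by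
              rw [Finset.mul_sum]
          _ ≤ (l * M * W * h) * (b * s t) := by
              gcongr
              exact hpath.sum_beta_mul_le hω.le hα0 hβ0 t
          _ = _ := by ring
      rw [hEeq t ht1]
      calc _ ≤ 2 * η * L * (h * s t) + p * (B * L + A * (2 * L * d' + d' ^ 2 * L)) * (h * s t)
            + q * (B * L) * (h * s t) + l * (b * W) * M * (h * s t) :=
            (abs_add_le _ _).trans (add_le_add ((abs_add_le _ _).trans (add_le_add
              ((abs_add_le _ _).trans (add_le_add b1 b2)) b3)) b4)
        _ = (g + l * (b * W) * M) * (h * s t) := by rw [hg]; ring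
        _ = M * h * s t := by rw [hgM]; ring
  intro t ht1 htn
  have := hstep n le_rfl t htn
  rwa [hE, causalPart_of_pos _ ht1] at this

/-- Comparison of quotients: if `x' ≈ x` and `v ≈ s ^ 2` relative to `s`, then `|x' / √v|` is
close to `|x / s|`. -/
lemma abs_div_sqrt_bounds {e x x' s v k κ : ℝ} (hx : x = s * e) (hs : 0 < s) (hv : 1 ≤ κ * √v)
    (h1 : |x' - x| ≤ k) (h2 : |v - s ^ 2| ≤ k * s) (hv0 : 0 < v) :
    |e| * (1 - κ * k) - κ * k ≤ |x' / √v| ∧ |x' / √v| ≤ |e| * (1 + κ * k) + κ * k := by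
  have hv' : 0 < √v := Real.sqrt_pos.2 hv0
  have hk : 0 ≤ k := (abs_nonneg _).trans h1
  have h3 : |√v - s| ≤ k := by
    have e1 : |√v - s| * (√v + s) = |v - s ^ 2| := by
      have h := abs_mul (√v - s) (√v + s)
      rw [abs_of_pos (add_pos hv' hs)] at h
      rw [← h]
      congr 1
      linear_combination Real.sq_sqrt hv0.le
    have e2 : |√v - s| * s ≤ k * s := by
      refine le_trans ?_ (e1.le.trans h2)
      gcongr
      linarith
    exact le_of_mul_le_mul_right e2 hs
  have hxe : |x| = s * |e| := by rw [hx, abs_mul, abs_of_pos hs]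
  have h4 := abs_le.1 h3
  have he := abs_nonneg e
  have h5 : |x'| ≤ |x| + k := by have := abs_sub_abs_le_abs_sub x' x; linarith
  have h6 : |x| - k ≤ |x'| := by
    have := abs_sub_abs_le_abs_sub x x'; rw [abs_sub_comm] at this; linarith
  have h7 : k * 1 ≤ k * (κ * √v) := by gcongr
  have h8 : |e| * (k * 1) ≤ |e| * (k * (κ * √v)) := by gcongr
  have h9 : |e| * (s - √v) ≤ |e| * k := by gcongr; linarith
  have h10 : |e| * (√v - s) ≤ |e| * k := by gcongr; linarith
  rw [abs_div, abs_of_pos hv']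
  constructor
  · rw [le_div_iff₀ hv']
    nlinarith
  · rw [div_le_iff₀ hv']
    nlinarith

/-- The residuals approximate the innovations along every path that grows at most like
`(1 + |t|) ^ (1 / 2 - γ)`, with errors that depend on the path only through its rate of growth. -/
lemma exists_residual_bounds {θ₀ : Param P Q p q}
    (hvartheta : ∀ z : ℂ, ‖z‖ ≤ 1 → lagPoly θ₀.vartheta z ≠ 0)
    (hω : 0 < θ₀.omega) (hα : ∀ j, 0 < θ₀.alpha j) (hβ : ∀ j, 0 < θ₀.beta j)
    {γ : ℝ} (hγ0 : 0 ≤ γ) (hγ1 : γ ≤ 1 / 2) {m : ℕ} (hpm : p ≤ m) (hqm : q ≤ m)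
    (hcontr : √(∑ j, θ₀.beta j) * weight γ m < 1) {η R : ℝ} (hη : 0 ≤ η) (hR : 0 ≤ R) :
    ∃ C : ℝ, 0 ≤ C ∧ ∀ᶠ n : ℕ in atTop, ∀ y x s e : ℤ → ℝ, IsPath θ₀ y x s →
      (∀ t, x t = s t * e t) →
      (∀ t, |y t| ≤ R * weight (1 / 2 - γ) t) → (∀ t, |x t| ≤ R * weight (1 / 2 - γ) t) →
      (∀ t : ℤ, -m ≤ t → s t ≤ R * weight (1 / 2 - γ) t) →
      ∀ θ : Param P Q p q, (∀ j, 0 ≤ θ.alpha j) → (∀ j, 0 ≤ θ.beta j) →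
      √(n : ℝ) * ‖θ - θ₀‖ ≤ η →
      ∀ t : ℤ, 1 ≤ t → t ≤ n →
        |e t| * (1 - C * weight (-γ) t) - C * weight (-γ) t ≤ |residual θ y t| ∧
        |residual θ y t| ≤ |e t| * (1 + C * weight (-γ) t) + C * weight (-γ) t := by
  obtain ⟨d, hd, hD⟩ := exists_abs_xHat_sub_le hvartheta hγ0 hγ1 hη hR
  obtain ⟨C, hC, hE⟩ := exists_abs_sigmaHatSq_sub_le hω hα hβ hγ0 hγ1 hpm hqm hcontr hη hR hd
  set κ : ℝ := (√(θ₀.omega / 2))⁻¹ with hκ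
  have hω2 : 0 < √(θ₀.omega / 2) := Real.sqrt_pos.2 (by linarith)
  refine ⟨κ * (d + C), by positivity, ?_⟩
  filter_upwards [hD, hE, eventually_ge_atTop 1,
    eventually_le_mul_sqrt η (half_pos hω)] with
    n hD hE hn1 hnω y x s e hpath hxe hy hx hs θ hθα hθβ hθ t ht1 htn
  have hn0 : 0 < √(n : ℝ) := Real.sqrt_pos.2 (by exact_mod_cast hn1)
  have hD := hD y x s hpath hy hx θ hθ
  have hE := hE y x s hpath hx hs θ hθα hθβ hθ hD t ht1 htn
  have hD := hD t htn
  rw [causalPart_of_pos _ ht1] at hD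
  have hst : 0 < s t := by
    have h1 := hpath.omega_le_sq (fun j => (hα j).le) (fun j => (hβ j).le) t
    exact (hpath.nonneg t).lt_of_ne fun h0 => by rw [← h0] at h1; norm_num at h1; linarith
  have hωθ : θ₀.omega / 2 ≤ θ.omega := by
    have h1 := mul_le_mul_of_nonneg_left ((θ - θ₀).abs_omega_le) hn0.le
    have h2 := h1.trans (hθ.trans hnω)
    rw [mul_comm] at h2
    have h3 := neg_le_of_abs_le (le_of_mul_le_mul_right h2 hn0)
    have h4 : (θ - θ₀).omega = θ.omega - θ₀.omega := rfl
    linarith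
  have hnn : ∀ N : ℕ, ∀ u : ℤ, u ≤ N → 0 ≤ sigmaHatSq θ y u := by
    intro N
    induction N with
    | zero => exact fun u hu => (sigmaHatSq_of_nonpos θ y (by simpa using hu)).ge
    | succ N ih =>
      intro u hu
      rcases le_or_gt u 0 with hu0 | hu0
      · exact (sigmaHatSq_of_nonpos θ y hu0).ge
      · rw [sigmaHatSq_of_pos θ y hu0]
        have h1 := Finset.sum_nonneg fun (j : Fin p) (_ : j ∈ Finset.univ) =>
          mul_nonneg (hθα j) (sq_nonneg (xHat θ y (u - ((j : ℕ) + 1))))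
        have h2 := Finset.sum_nonneg fun (j : Fin q) (_ : j ∈ Finset.univ) =>
          mul_nonneg (hθβ j) (ih (u - ((j : ℕ) + 1)) (by push_cast at hu; omega))
        linarith
  have hv : θ₀.omega / 2 ≤ sigmaHatSq θ y t := by
    rw [sigmaHatSq_of_pos θ y ht1]
    have h1 := Finset.sum_nonneg fun (j : Fin p) (_ : j ∈ Finset.univ) =>
      mul_nonneg (hθα j) (sq_nonneg (xHat θ y (t - ((j : ℕ) + 1))))
    have h2 := Finset.sum_nonneg fun (j : Fin q) (_ : j ∈ Finset.univ) =>
      mul_nonneg (hθβ j) (hnn _ (t - ((j : ℕ) + 1)) (Int.self_le_toNat _))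
    linarith
  have hw := weight_pos (-γ) t
  have := abs_div_sqrt_bounds (k := (d + C) * weight (-γ) t) (κ := κ) (hxe t) hst
    (v := sigmaHatSq θ y t) (x' := xHat θ y t)
    (by rw [hκ, ← div_eq_inv_mul, one_le_div hω2]; exact Real.sqrt_le_sqrt hv)
    (hD.trans (by gcongr; linarith)) (hE.trans (by gcongr; linarith)) (by linarith)
  rw [← mul_assoc] at this
  exact this

/-! ### Growth of stationary processes -/

variable {Ω : Type*} [MeasurableSpace Ω] {μ : Measure Ω}

lemma StrictlyStationary.identDistrib {Z : ℤ → Ω → ℝ} (h : StrictlyStationary μ Z) (t : ℤ) :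
    IdentDistrib (Z 0) (Z t) μ μ := by
  have := (h t).comp (measurable_pi_apply (0 : ℤ))
  simpa [Function.comp_def] using this

lemma tendsto_measure_zero_of_ae_exists_notMem [IsFiniteMeasure μ] {A : ℕ → Set Ω}
    (hA : ∀ r, MeasurableSet (A r)) (hanti : Antitone A) (h : ∀ᵐ w ∂μ, ∃ r, w ∉ A r) :
    Tendsto (fun r => μ (A r)) atTop (𝓝 0) := by
  have h0 : μ (⋂ r, A r) = 0 := by
    rw [measure_eq_zero_iff_ae_notMem]
    simpa using h
  rw [← h0]
  exact tendsto_measure_iInter_atTop (fun r => (hA r).nullMeasurableSet) hanti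
    ⟨0, measure_ne_top _ _⟩

lemma StrictlyStationary.boundedInProbability [IsFiniteMeasure μ] {Z : ℤ → Ω → ℝ}
    (h : StrictlyStationary μ Z) (hZ : ∀ t, Measurable (Z t)) :
    BoundedInProbability μ fun w t => (Z t w : ℂ) := by
  intro κ hκ
  have hmeas : ∀ r : ℕ, MeasurableSet {x : ℝ | (r : ℝ) < |x|} := fun r =>
    measurableSet_lt measurable_const measurable_id.abs
  have ht := tendsto_measure_zero_of_ae_exists_notMem (μ := μ)
    (A := fun r : ℕ => Z 0 ⁻¹' {x : ℝ | (r : ℝ) < |x|}) (fun r => hZ 0 (hmeas r))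
    (fun r r' hr w hw => show (r : ℝ) < |Z 0 w| from
      (Nat.cast_le.2 hr).trans_lt (show (r' : ℝ) < |Z 0 w| from hw))
    (Eventually.of_forall fun w => by
      obtain ⟨r, hr⟩ := exists_nat_ge |Z 0 w|
      exact ⟨r, not_lt.2 hr⟩)
  obtain ⟨r, hr, hr1⟩ := ((ENNReal.tendsto_nhds_zero.1 ht κ hκ).and (eventually_ge_atTop 1)).exists
  refine ⟨r, by exact_mod_cast hr1, fun t => ?_⟩
  have := (h.identDistrib t).measure_mem_eq (hmeas r)
  simp only [Complex.norm_real, Real.norm_eq_abs]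
  exact this.symm.le.trans hr

/-- A strictly stationary process with a finite absolute moment of order `k` grows at most like
`|t| ^ c`, almost surely, for every `c > 1 / k`. -/
lemma StrictlyStationary.ae_exists_abs_le_weight {Z : ℤ → Ω → ℝ} (h : StrictlyStationary μ Z)
    (hZ : ∀ t, Measurable (Z t)) {k c : ℝ} (hk : 0 < k) (hc : 1 < c * k)
    (hint : Integrable (fun w => |Z 0 w| ^ k) μ) :
    ∀ᵐ w ∂μ, ∃ R : ℝ, 0 ≤ R ∧ ∀ t, |Z t w| ≤ R * weight c t := by
  have hm : ∀ t, Measurable fun w => ENNReal.ofReal (|Z t w| ^ k) := fun t =>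
    ((hZ t).abs.pow_const k).ennreal_ofReal
  set I := ∫⁻ w, ENNReal.ofReal (|Z 0 w| ^ k) ∂μ with hI
  have hIfin : I ≠ ∞ := by
    rw [hI, ← ofReal_integral_eq_lintegral_ofReal hint
      (Eventually.of_forall fun w => by positivity)]
    exact ENNReal.ofReal_ne_top
  have hIt : ∀ t, ∫⁻ w, ENNReal.ofReal (|Z t w| ^ k) ∂μ = I := by
    intro t
    have hg : Measurable fun x : ℝ => ENNReal.ofReal (|x| ^ k) :=
      (measurable_id.abs.pow_const k).ennreal_ofReal
    exact ((h.identDistrib t).comp hg).lintegral_eq.symm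
  have hsum : ∫⁻ w, ∑' t : ℤ, ENNReal.ofReal (|Z t w| ^ k)
      * ENNReal.ofReal (weight (-(c * k)) t) ∂μ ≠ ∞ := by
    rw [lintegral_tsum fun t => ((hm t).mul_const _).aemeasurable]
    simp_rw [lintegral_mul_const _ (hm _), hIt, ENNReal.tsum_mul_left]
    refine ENNReal.mul_ne_top hIfin ?_
    exact (summable_weight hc).tsum_ofReal_ne_top
  have hae := ae_lt_top (Measurable.tsum fun t => (hm t).mul_const _) hsum
  filter_upwards [hae] with w hw
  set S := ∑' t : ℤ, ENNReal.ofReal (|Z t w| ^ k) * ENNReal.ofReal (weight (-(c * k)) t)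
  refine ⟨S.toReal ^ k⁻¹, by positivity, fun t => ?_⟩
  have h1 := ENNReal.toReal_mono hw.ne (ENNReal.le_tsum (f := fun t : ℤ =>
    ENNReal.ofReal (|Z t w| ^ k) * ENNReal.ofReal (weight (-(c * k)) t)) t)
  have hwk : weight (-(c * k)) t = (weight c t ^ k)⁻¹ := by
    unfold weight
    rw [Real.rpow_neg (by positivity), Real.rpow_mul (by positivity)]
  have hwp := weight_pos c t
  rw [ENNReal.toReal_mul, ENNReal.toReal_ofReal (by positivity),
    ENNReal.toReal_ofReal (weight_pos _ _).le, hwk, ← div_eq_mul_inv,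
    div_le_iff₀ (by positivity)] at h1
  have h2 := Real.rpow_le_rpow (by positivity) h1 (inv_nonneg.2 hk.le)
  rwa [Real.mul_rpow (by positivity) (by positivity), Real.rpow_rpow_inv (by positivity) hk.ne',
    Real.rpow_rpow_inv (by positivity) hk.ne'] at h2

/-- The errors transmit their growth to the observations. -/
lemma ae_exists_abs_le_weight_of_arma {θ₀ : Param P Q p q} {Y X : ℤ → Ω → ℝ}
    (hphi : ∀ z : ℂ, ‖z‖ = 1 → lagPoly θ₀.phi z ≠ 0)
    (hY : BoundedInProbability μ fun w t => (Y t w : ℂ))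
    (harma : ∀ t, ∀ᵐ w ∂μ, Y t w = ∑ j : Fin P, θ₀.phi j * Y (t - ((j : ℕ) + 1)) w
      + X t w - ∑ j : Fin Q, θ₀.vartheta j * X (t - ((j : ℕ) + 1)) w)
    {c : ℝ} (hc : |c| ≤ 1)
    (hX : ∀ᵐ w ∂μ, ∃ R : ℝ, 0 ≤ R ∧ ∀ t, |X t w| ≤ R * weight c t) :
    ∀ᵐ w ∂μ, ∃ R : ℝ, 0 ≤ R ∧ ∀ t, |Y t w| ≤ R * weight c t := by
  have hmod := moderate_weight hc
  filter_upwards [ae_isBigO_of_aeval_lag hmod (lagPolynomial_ne_zero θ₀.phi)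
    (fun z hz => by rw [eval_lagPolynomial]; exact hphi z hz) hY, ae_all_iff.2 harma, hX]
    with w h1 h2 ⟨R, hR, h3⟩
  have h4 : (fun t => (Y t w : ℂ)) =O[⊤] weight c := by
    refine h1 (Asymptotics.isBigO_top.2
      ⟨R + ∑ j : Fin Q, |θ₀.vartheta j| * (R * (1 + ((j : ℕ) + 1))), fun t => ?_⟩)
    rw [aeval_lagPolynomial_ofReal θ₀.phi (fun t => Y t w), Complex.norm_real, Real.norm_eq_abs,
      Real.norm_of_nonneg (weight_pos _ _).le, add_mul, Finset.sum_mul]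
    have e : Y t w - ∑ j : Fin P, θ₀.phi j * Y (t - ((j : ℕ) + 1)) w
        = X t w - ∑ j : Fin Q, θ₀.vartheta j * X (t - ((j : ℕ) + 1)) w := by
      have := h2 t
      linarith
    rw [e]
    refine (abs_sub _ _).trans (add_le_add (h3 t) ((Finset.abs_sum_le_sum_abs _ _).trans
      (Finset.sum_le_sum fun j _ => ?_)))
    rw [abs_mul, mul_assoc, mul_assoc]
    gcongr
    refine (h3 _).trans ?_
    gcongr
    have := hmod.2 t (-((j : ℕ) + 1))
    rw [← sub_eq_add_neg] at this
    push_cast at this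
    rwa [abs_neg, abs_of_nonneg (by positivity)] at this
  obtain ⟨C, hC, h5⟩ := h4.exists_nonneg
  rw [Asymptotics.isBigOWith_top] at h5
  refine ⟨C, hC, fun t => ?_⟩
  have := h5 t
  rwa [Complex.norm_real, Real.norm_eq_abs, Real.norm_of_nonneg (weight_pos _ _).le] at this

/-! ### Approximation of the innovations -/

/-- The exponent of the weights: small enough for the moment condition to control the growth of
the errors and for the volatility recursion to be contractive in the weighted norm. -/
lemma exists_exponent {δ b : ℝ} (hδ : 0 < δ) (hb1 : b < 1) (m : ℕ) :
    ∃ γ : ℝ, 0 < γ ∧ γ ≤ 1 / 2 ∧ 1 < (1 / 2 - γ) * (2 + δ) ∧ √b * weight γ m < 1 := by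
  have h1 : ∀ᶠ γ : ℝ in 𝓝 0, 1 < (1 / 2 - γ) * (2 + δ) := by
    have hc : Continuous fun γ : ℝ => (1 / 2 - γ) * (2 + δ) := by fun_prop
    refine (hc.tendsto 0).eventually_const_lt ?_
    linarith
  have h2 : ∀ᶠ γ : ℝ in 𝓝 0, √b * weight γ m < 1 := by
    have hc : Continuous fun γ : ℝ => √b * weight γ m := by
      unfold weight
      exact continuous_const.mul (Real.continuous_const_rpow (by positivity))
    refine hc.continuousAt.eventually_lt_const ?_
    have : √b < 1 := by rw [Real.sqrt_lt' one_pos]; simpa using hb1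
    simpa [weight] using this
  have h3 : ∀ᶠ γ : ℝ in 𝓝 0, γ ≤ 1 / 2 := Iic_mem_nhds (by norm_num)
  obtain ⟨γ, ⟨h1, h2, h3⟩, h0⟩ := (((h1.and (h2.and h3)).filter_mono
    (nhdsWithin_le_nhds (s := Set.Ioi 0))).and self_mem_nhdsWithin).exists
  exact ⟨γ, h0, h3, h1, h2⟩

lemma tendstoInMeasure_sup'_weight [IsFiniteMeasure μ] {γ : ℝ} (hγ : 0 < γ) {l : ℕ → ℕ}
    (hl : ∀ n, l n ≤ n) (hlt : Tendsto l atTop atTop) :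
    TendstoInMeasure μ (fun n (_ : Ω) => (Finset.Icc (l n) n).sup'
      (Finset.nonempty_Icc.2 (hl n)) fun t => weight (-γ) t) atTop fun _ => (0 : ℝ) := by
  have h : ∀ n, (Finset.Icc (l n) n).sup' (Finset.nonempty_Icc.2 (hl n))
      (fun t => weight (-γ) t) = weight (-γ) (l n) := by
    intro n
    refine le_antisymm (Finset.sup'_le _ _ fun t ht => ?_)
      (Finset.le_sup' (fun t : ℕ => weight (-γ) t) (Finset.left_mem_Icc.2 (hl n)))
    rw [weight_neg, weight_neg]
    refine inv_anti₀ (weight_pos _ _) (weight_mono hγ.le ?_)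
    simpa using (Finset.mem_Icc.1 ht).1
  simp only [h]
  refine tendstoInMeasure_of_tendsto_ae (fun _ => aestronglyMeasurable_const)
    (Eventually.of_forall fun w => ?_)
  simp only [weight_neg]
  exact (tendsto_inv_atTop_zero.comp (tendsto_weight_atTop hγ)).comp hlt

end ArmaGarch

open ArmaGarch in
theorem theorem4 {Ω : Type*} [mΩ : MeasurableSpace Ω] (μ : Measure Ω) [IsProbabilityMeasure μ]
    (ℱ : Filtration ℤ mΩ) {P Q p q : ℕ}
    -- the parameter space and the true parameter
    (ΘARMA : Set ((Fin P → ℝ) × (Fin Q → ℝ)))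
    (ΘGARCH : Set (ℝ × (Fin p → ℝ) × (Fin q → ℝ)))
    (hΘ : ∀ x ∈ ΘGARCH, 0 < x.1 ∧ (∀ j, 0 ≤ x.2.1 j) ∧ (∀ j, 0 ≤ x.2.2 j))
    (θ₀ : ArmaGarch.Param P Q p q) (hθ₀ : θ₀ ∈ ΘARMA ×ˢ ΘGARCH)
    (hα : ∀ j, 0 < θ₀.alpha j) (hβ : ∀ j, 0 < θ₀.beta j)
    -- the strictly stationary ARMA--GARCH model
    (Y X σ ε : ℤ → Ω → ℝ) (hmodel : ArmaGarch.IsModel μ ℱ θ₀ Y X σ ε)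
    (hYstat : ArmaGarch.StrictlyStationary μ Y) (hXstat : ArmaGarch.StrictlyStationary μ X)
    -- (a)
    (hcommon : ∀ z : ℂ,
      ¬ (ArmaGarch.lagPoly θ₀.phi z = 0 ∧ ArmaGarch.lagPoly θ₀.vartheta z = 0))
    (hphi : ∀ z : ℂ, ‖z‖ = 1 → ArmaGarch.lagPoly θ₀.phi z ≠ 0)
    (hvartheta : ∀ z : ℂ, ‖z‖ ≤ 1 → ArmaGarch.lagPoly θ₀.vartheta z ≠ 0)
    -- (b)
    (hgarch : ∑ j, θ₀.alpha j + ∑ j, θ₀.beta j < 1)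
    -- (c)
    (hmoment : ∃ δ : ℝ, 0 < δ ∧ ∀ t, Integrable (fun w => |X t w| ^ (2 + δ)) μ)
    -- the estimator
    (hest : ArmaGarch.HasRootNConsistentEstimator μ (ΘARMA ×ˢ ΘGARCH) θ₀ Y) :
    ArmaGarch.UniformlyApproximable μ
      (fun n η => ArmaGarch.nbhd (ΘARMA ×ˢ ΘGARCH) θ₀ n η) ε
      (fun θ t w => ArmaGarch.residual θ (fun u => Y u w) t) := by
  obtain ⟨δ, hδ, hmom⟩ := hmoment
  have hω : 0 < θ₀.omega := (hΘ _ hθ₀.2).1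
  have hα0 : ∀ j, 0 ≤ θ₀.alpha j := fun j => (hα j).le
  have hβ0 : ∀ j, 0 ≤ θ₀.beta j := fun j => (hβ j).le
  have hβ1 : ∑ j, θ₀.beta j < 1 := by
    have := Finset.sum_nonneg fun j (_ : j ∈ Finset.univ) => hα0 j
    linarith
  set m : ℕ := p + q with hm
  obtain ⟨γ, hγ0, hγ1, hγδ, hcontr⟩ := exists_exponent hδ hβ1 m
  set c : ℝ := 1 / 2 - γ with hc
  have hc0 : 0 ≤ c := by linarith
  have hc1 : c ≤ 1 := by linarith
  have hσm : ∀ t, Measurable (σ t) := fun t => (hmodel.measurable_sigma t).mono (ℱ.le _) le_rfl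
  have hpath : ∀ᵐ w ∂μ, IsPath θ₀ (fun t => Y t w) (fun t => X t w) (fun t => σ t w) := by
    filter_upwards [ae_all_iff.2 hmodel.arma, ae_all_iff.2 hmodel.sigma_nonneg,
      ae_all_iff.2 hmodel.sigma_sq] with w h1 h2 h3
    exact ⟨h1, h2, h3⟩
  have hXgrowth := hXstat.ae_exists_abs_le_weight hmodel.measurable_X (by linarith) hγδ (hmom 0)
  have hYgrowth := ae_exists_abs_le_weight_of_arma hphi
    (hYstat.boundedInProbability hmodel.measurable_Y) hmodel.arma
    (by rwa [abs_of_nonneg hc0]) hXgrowth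
  -- the paths that do not grow at rate `r`
  set A : ℕ → Set Ω := fun r => {w | (∀ t, |Y t w| ≤ r * weight c t) ∧
    (∀ t, |X t w| ≤ r * weight c t) ∧ ∀ t : ℤ, -m ≤ t → σ t w ≤ r * weight c t}ᶜ with hA
  have hAmeas : ∀ r, MeasurableSet (A r) := by
    intro r
    have e : A r = ((⋂ t, {w | |Y t w| ≤ r * weight c t}) ∩ ((⋂ t, {w | |X t w| ≤ r * weight c t})
        ∩ ⋂ (t : ℤ) (_ : -(m : ℤ) ≤ t), {w | σ t w ≤ r * weight c t}))ᶜ := by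
      ext w
      simp [hA]
    rw [e]
    exact ((MeasurableSet.iInter fun t =>
        measurableSet_le (hmodel.measurable_Y t).abs measurable_const).inter
      ((MeasurableSet.iInter fun t =>
        measurableSet_le (hmodel.measurable_X t).abs measurable_const).inter
      (MeasurableSet.iInter fun t => MeasurableSet.iInter fun _ =>
        measurableSet_le (hσm t) measurable_const))).compl
  have hAanti : Antitone A := by
    intro r r' hr
    refine Set.compl_subset_compl.2 fun w hw => ?_
    have hmono : ∀ t, (r : ℝ) * weight c t ≤ r' * weight c t := fun t =>
      mul_le_mul_of_nonneg_right (by exact_mod_cast hr) (weight_pos _ _).le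
    exact ⟨fun t => (hw.1 t).trans (hmono t), fun t => (hw.2.1 t).trans (hmono t),
      fun t ht => (hw.2.2 t ht).trans (hmono t)⟩
  have hAlim : Tendsto (fun r => μ (A r)) atTop (𝓝 0) := by
    refine tendsto_measure_zero_of_ae_exists_notMem hAmeas hAanti ?_
    filter_upwards [hXgrowth, hYgrowth, hpath] with w ⟨R₁, hR₁, h1⟩ ⟨R₂, hR₂, h2⟩ h3
    obtain ⟨R₃, hR₃, h3⟩ := h3.exists_le_weight hω.le hα0 hβ0 hβ1 hc0 hc1 hR₁ h1
      (m := m) (by omega) (by omega)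
    obtain ⟨r, hr⟩ := exists_nat_ge (R₁ + R₂ + R₃)
    have hmono : ∀ {R : ℝ}, R ≤ R₁ + R₂ + R₃ → ∀ t, R * weight c t ≤ r * weight c t :=
      fun hR t => mul_le_mul_of_nonneg_right (hR.trans hr) (weight_pos _ _).le
    exact ⟨r, not_not.2 ⟨fun t => (h2 t).trans (hmono (by linarith) t),
      fun t => (h1 t).trans (hmono (by linarith) t),
      fun t ht => (h3 t ht).trans (hmono (by linarith) t)⟩⟩
  intro η hη
  refine ⟨fun _ t _ => weight (-(γ / 2)) t, fun _ t _ => weight (-(γ / 2)) t,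
    fun _ _ => measurable_const, fun _ _ => measurable_const,
    fun _ t _ => (weight_pos _ _).le, fun _ t _ => (weight_pos _ _).le, fun l hl hlt => ?_⟩
  refine ⟨tendstoInMeasure_sup'_weight (half_pos hγ0) hl hlt,
    tendstoInMeasure_sup'_weight (half_pos hγ0) hl hlt, ?_⟩
  rw [ENNReal.tendsto_nhds_zero]
  intro κ hκ
  obtain ⟨r, hr⟩ := (ENNReal.tendsto_nhds_zero.1 hAlim κ hκ).exists
  obtain ⟨C, hC, hres⟩ := exists_residual_bounds hvartheta hω hα hβ hγ0.le hγ1 (m := m)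
    (by omega) (by omega) hcontr hη.le (Nat.cast_nonneg r)
  -- the constant `C` is absorbed by passing from the exponent `γ` to `γ / 2`
  have hCw : ∀ᶠ n in atTop, ∀ t, l n ≤ t → C * weight (-γ) t ≤ weight (-(γ / 2)) t := by
    refine hlt.eventually (eventually_forall_ge_atTop.2 ?_)
    filter_upwards [(tendsto_weight_atTop (half_pos hγ0)).eventually_ge_atTop C] with t ht
    have hw := weight_pos (-(γ / 2)) t
    have e1 : weight (-γ) t = weight (-(γ / 2)) t * weight (-(γ / 2)) t := by
      unfold weight
      rw [← Real.rpow_add (by positivity)]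
      congr 1; ring
    have e2 : weight (γ / 2) t * weight (-(γ / 2)) t = 1 := by
      rw [weight_neg]; exact mul_inv_cancel₀ (weight_pos _ _).ne'
    rw [e1, ← mul_assoc]
    refine (mul_le_mul_of_nonneg_right (mul_le_mul_of_nonneg_right ht hw.le) hw.le).trans ?_
    rw [e2, one_mul]
  filter_upwards [hres, hCw, hlt.eventually_ge_atTop 1] with n hres hCw hl1
  refine (measure_mono_ae ?_).trans hr
  filter_upwards [hpath, ae_all_iff.2 hmodel.garch] with w hw hXσ hfail
  by_contra hAr
  obtain ⟨hy, hx, hs⟩ := not_not.1 hAr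
  refine hfail fun t ht θ hθ => ?_
  obtain ⟨htl, htn⟩ := Finset.mem_Icc.1 ht
  obtain ⟨-, hθα, hθβ⟩ := hΘ _ hθ.1.2
  have hb := hres _ _ _ (fun t => ε t w) hw hXσ hy hx hs θ hθα hθβ hθ.2 t (by omega) (by omega)
  have hCt := hCw t htl
  have he := abs_nonneg (ε t w)
  constructor
  · refine le_trans ?_ hb.1
    gcongr
  · refine hb.2.trans ?_
    gcongr
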